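/- Let $\mathbb H_L$ be the hyperbolic plane of curvature $-1/L^2$ ($L>0$), i.e. the constant time slice of $\mathrm{AdS}_3$ with radius $L$, with metric $L^2(d\rho^2+\sinh^2\!\rho\,d\chi^2)$ in polar coordinates and with the circle of directions $\chi\in\mathbb R/2\pi\mathbb Z$ as its boundary at infinity. Let $\mathcal K=\{(\theta,\alpha):0\le\theta<2\pi,\ 0<\alpha<\pi\}$ be its kinematic space: $\gamma=(\theta,\alpha)$ is the oriented complete geodesic from the boundary point $u=\theta-\alpha$ to the boundary point $v=\theta+\alpha$. Let $G_N>0$, let $S(\alpha)=\frac{L}{2G_N}\log\frac{2\sin\alpha}{\epsilon}$ with a cutoff $\epsilon>0$ be the entanglement entropy of the boundary interval $[u,v]$ (the regularized length of $\gamma$ divided by $4G_N$), and let $\omega=\partial_u\partial_vS\,du\wedge dv=-\frac12\,\partial_\alpha^2S\;d\theta\wedge d\alpha$ be the Crofton form. Let $n\ge 2$, $e=4(n-1)$, and let $Q\subset\mathbb H_L$ be a closed convex hyperbolic $e$-gon, with edges labelled $1,\dots,e$ in counterclockwise order, all of whose interior angles equal $\pi/2$ (the shape of the island of an $n$-exit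 wormhole). Let $\mathcal K_Q\subset\mathcal K$ be the set of geodesics that meet $Q$, let $\lambda_Q(\gamma)$ be the length of $\gamma\cap Q$, and for $i\ne j$ let $s_{ij}\subset\mathcal K$ be the set of geodesics that enter $Q$ through the (closed) $i$-th edge and exit $Q$ through the (closed) $j$-th edge. Then $\mathcal K_Q=\bigcup_{i\neq j}s_{ij}$, and distinct sectors $s_{ij}$ overlap only in sets of measure zero. The function $\lambda_Q$ is integrable against $\omega$ on every $s_{ij}$, the sector integrals $$\mathcal I_{ij}=\frac{2G_N}{\pi}\int_{s_{ij}}\lambda_Q\,\omega\qquad(i\ne j)$$ satisfy $\mathcal I_{ij}=\mathcal I_{ji}$, and $$2\sum_{i=1}^{e}\sum_{j>i}^{e}\mathcal I_{ij}=2\pi(n-2)L^2 .$$ This sum is the area of $Q$; in particular it does not depend on the position or the shape of $Q$ (the placement of the boundary regions), but only on $n$. -/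

import Mathlib

namespace KinematicSpace

open Complex MeasureTheory Set

noncomputable section

/-!
The constant time slice is the hyperbolic plane of curvature `-1 / L ^ 2`, in the projective
(Beltrami-Klein) disk model: the point with geodesic polar coordinates `(ρ, χ)`, in which the
metric is `L ^ 2 * (dρ ^ 2 + sinh ρ ^ 2 * dχ ^ 2)`, is the point `tanh ρ * exp (χ * I)` of the open
unit disk of `ℂ`. The geodesics of this model are the straight chords of the unit circle.
-/

/-- The Riemannian metric of radius `L` at the point `x` of the disk, on tangent vectors
`v` and `w`. -/
def metric (L : ℝ) (x v w : ℂ) : ℝ :=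
  L ^ 2 * (inner ℝ v w / (1 - ‖x‖ ^ 2) + inner ℝ x v * inner ℝ x w / (1 - ‖x‖ ^ 2) ^ 2)

/-- The Riemannian volume (area) of a region of the disk: the integral of the square root of the
determinant of the metric. -/
def area (L : ℝ) (Q : Set ℂ) : ℝ :=
  ∫ x in Q, √(metric L x 1 1 * metric L x I I - metric L x 1 I ^ 2)

/-- The point of the boundary circle at angle `φ`. -/
def boundaryPoint (φ : ℝ) : ℂ := Complex.exp (φ * I)

/-- The kinematic space of oriented boundary anchored geodesics, in the coordinates
`(θ, α) = ((v + u) / 2, (v - u) / 2)`, where the geodesic runs from the boundary point at angle `u`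
to the one at angle `v`. Every ordered pair of distinct boundary points has exactly one such
pair of coordinates. -/
def kinematicSpace : Set (ℝ × ℝ) := Ico 0 (2 * Real.pi) ×ˢ Ioo 0 Real.pi

/-- The oriented geodesic with coordinates `γ = (θ, α)`, parametrized by `0 < t < 1`: the chord from
the boundary point at `u = θ - α` to the boundary point at `v = θ + α`. -/
def geodesic (γ : ℝ × ℝ) (t : ℝ) : ℂ :=
  AffineMap.lineMap (boundaryPoint (γ.1 - γ.2)) (boundaryPoint (γ.1 + γ.2)) t

/-- The parameters at which the geodesic `γ` is in `Q`. -/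
def times (Q : Set ℂ) (γ : ℝ × ℝ) : Set ℝ := {t | t ∈ Ioo (0 : ℝ) 1 ∧ geodesic γ t ∈ Q}

/-- The part of kinematic space that consists of the geodesics with nonempty intersection
with `Q`. -/
def geodesicsMeeting (Q : Set ℂ) : Set (ℝ × ℝ) :=
  {γ | γ ∈ kinematicSpace ∧ (geodesic γ '' Ioo 0 1 ∩ Q).Nonempty}

/-- The chord: the hyperbolic length of the intersection of `γ` with `Q`. -/
def chord (L : ℝ) (Q : Set ℂ) (γ : ℝ × ℝ) : ℝ :=
  ∫ t in times Q γ, √(metric L (geodesic γ t) (deriv (geodesic γ) t) (deriv (geodesic γ) t))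

/-- The entanglement entropy of a boundary interval of opening angle `α`, with UV cutoff `ε`:
`1 / (4 * G)` times the length `2 * L * log (2 * sin α / ε)` of the cut-off geodesic, equivalently
`(c / 3) * log (2 * sin α / ε)` with central charge `c = 3 * L / (2 * G)`. -/
def entropy (L G ε α : ℝ) : ℝ := L / (2 * G) * Real.log (2 * Real.sin α / ε)

/-- The density of the Crofton form `ω = ∂_u ∂_v S du ∧ dv = -(1 / 2) * ∂_α ^ 2 S dθ ∧ dα` with
respect to `dθ dα`. -/
def croftonDensity (L G ε : ℝ) (γ : ℝ × ℝ) : ℝ :=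
  -(1 / 2) * iteratedDeriv 2 (entropy L G ε) γ.2

/-- `p` lists, in counterclockwise order, the vertices of a (strictly convex) hyperbolic polygon all
of whose interior angles are right angles. The edges run from `p i` to `p (i + 1)`, cyclically; all
the other vertices are strictly to the left of the line through an edge. -/
structure IsRightAngledPolygon (L : ℝ) {e : ℕ} (p : Fin e → ℂ) : Prop where
  mem_disk : ∀ i, ‖p i‖ < 1
  convex : ∀ i j, j ≠ i → j ≠ finRotate e i →
    0 < ((starRingEnd ℂ) (p (finRotate e i) - p i) * (p j - p i)).im
  right_angle : ∀ i,
    metric L (p i) (p (finRotate e i) - p i) (p ((finRotate e).symm i) - p i) = 0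

/-- The closed region bounded by the polygon. -/
def region {e : ℕ} (p : Fin e → ℂ) : Set ℂ := convexHull ℝ (range p)

/-- The `i`-th edge, a closed geodesic segment. -/
def edge {e : ℕ} (p : Fin e → ℂ) (i : Fin e) : Set ℂ := segment ℝ (p i) (p (finRotate e i))

/-- The sector of the geodesics which enter the polygon through the `i`-th edge and exit it through
the `j`-th edge. -/
def sector {e : ℕ} (p : Fin e → ℂ) (i j : Fin e) : Set (ℝ × ℝ) :=
  {γ | γ ∈ kinematicSpace ∧
    (∃ s, IsLeast (times (region p) γ) s ∧ geodesic γ s ∈ edge p i) ∧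
    (∃ t, IsGreatest (times (region p) γ) t ∧ geodesic γ t ∈ edge p j)}

/-- The integrand `λ_Q ω` as a function of the coordinates `(θ, α)`. -/
def weightedChord (L G ε : ℝ) {e : ℕ} (p : Fin e → ℂ) (γ : ℝ × ℝ) : ℝ :=
  chord L (region p) γ * croftonDensity L G ε γ

/-- The sector integral `(2 * G / π) ∫_{s_ij} λ_Q ω`. -/
def sectorIntegral (L G ε : ℝ) {e : ℕ} (p : Fin e → ℂ) (i j : Fin e) : ℝ :=
  2 * G / Real.pi * ∫ γ in sector p i j, weightedChord L G ε p γ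

end

end KinematicSpace

namespace KinematicSpace

open Complex MeasureTheory Set

noncomputable section

/-! ### Oriented areas and convex polygons -/

/-! The proof computes the total integral of `λ_Q ω` in two ways. By the Crofton formula for areas,
the integral over all of kinematic space is `π / (2 * G)` times the area of `Q`. Cutting kinematic
space by entry and exit edges turns the same integral into the sum of the sector integrals.
Gauss-Bonnet then evaluates the area.

Crofton formula (`integral_chord`). In the Klein model the length element on a chord is `L / (2 * (t
* (1 - t))) dt`, and the cutoff drops out of `ω`, whose density is `L / (4 * G) / sin α ^ 2`. For
fixed `θ` the chords are parallel and fill the disk, so `(α, t)` are coordinates on the disk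
(`lintegral_chordKernel`). Tonelli exchanges `θ` with the point `x`, and integrating `1 / (1 - ⟨x,
exp (θ * I)⟩ ^ 2)` over a full turn gives `2 * π / √(gap x)` (`lintegral_angular`). The result is a
constant multiple of the hyperbolic area density `1 / gap ^ (3 / 2)`.

Area (`area_rightAngledPolygon`). A triangle has area equal to its angular defect
(`integral_density_triangle`): after a radial integration from one vertex, the remaining integrand
is the derivative of a sum of two angles. A convex polygon is a fan of triangles whose defects
telescope, leaving `(e - 2) * π - e * π / 2`.

Sectors. A geodesic enters `Q` through an edge that it crosses to the left and exits through one
that it crosses to the right, so these edges differ. Ambiguity of an edge means passing through a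
vertex, which is a null condition. Reversal of orientation exchanges `s_ij` and `s_ji`, so twice the
sum over `i < j` is the sum over all ordered pairs. -/

/-- The oriented area of the parallelogram spanned by two vectors. -/
def cross (u v : ℂ) : ℝ := ((starRingEnd ℂ) u * v).im

lemma cross_def (u v : ℂ) : cross u v = u.re * v.im - u.im * v.re := by
  simp [cross]; ring

lemma cross_swap (u v : ℂ) : cross u v = -cross v u := by
  simp only [cross_def]; ring

/-- The three-term Plücker relation among the 2 × 2 minors of four plane vectors. -/
lemma cross_mul_cross (u a b c : ℂ) :
    cross a c * cross u b = cross a b * cross u c + cross b c * cross u a := by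
  simp only [cross_def]; ring

lemma continuous_cross_sub (u a : ℂ) : Continuous fun x => cross u (x - a) := by
  simp only [cross_def]; fun_prop

lemma cross_sub_combo (u a x y : ℂ) {s t : ℝ} (h : s + t = 1) :
    cross u (s • x + t • y - a) = s * cross u (x - a) + t * cross u (y - a) := by
  obtain rfl : s = 1 - t := by linarith
  simp [cross_def]; ring

lemma convex_cross_nonneg (u a : ℂ) : Convex ℝ {x | 0 ≤ cross u (x - a)} := by
  intro x hx y hy s t hs ht hst
  simp only [mem_ofPred_eq, cross_sub_combo u a x y hst] at *
  positivity

lemma convex_cross_nonpos (u a : ℂ) : Convex ℝ {x | cross u (x - a) ≤ 0} := by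
  intro x hx y hy s t hs ht hst
  simp only [mem_ofPred_eq, cross_sub_combo u a x y hst] at *
  nlinarith [mul_nonneg hs (neg_nonneg.2 hx), mul_nonneg ht (neg_nonneg.2 hy)]

/-- The barycentric coordinates of `x` are the oriented areas of the three triangles that `x` forms
with the sides, divided by the total area `D`. -/
lemma mem_triangle {a b c x : ℂ} (h : 0 < cross (b - a) (c - a))
    (h₁ : 0 ≤ cross (b - a) (x - a)) (h₂ : 0 ≤ cross (c - b) (x - b))
    (h₃ : cross (c - a) (x - a) ≤ 0) : x ∈ convexHull ℝ {a, b, c} := by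
  set D := cross (b - a) (c - a) with hD
  rw [convexHull_insert (by simp), convexHull_pair]
  have key : cross (c - b) (x - b) + cross (b - a) (x - a) - cross (c - a) (x - a) = D := by
    simp only [hD, cross_def, sub_re, sub_im]; ring
  have hx : x = (cross (c - b) (x - b) / D) • a + (-cross (c - a) (x - a) / D) • b
      + (cross (b - a) (x - a) / D) • c := by
    apply Complex.ext
    · simp only [add_re, real_smul, re_ofReal_mul]
      field_simp
      simp only [hD, cross_def, sub_re, sub_im]; ring
    · simp only [add_im, real_smul, im_ofReal_mul]
      field_simp
      simp only [hD, cross_def, sub_re, sub_im]; ring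
  rw [← convexHull_pair, ← convexHull_insert (by simp)]
  have hc : Convex ℝ (convexHull ℝ ({a, b, c} : Set ℂ)) := convex_convexHull ℝ _
  have ha : a ∈ convexHull ℝ ({a, b, c} : Set ℂ) := subset_convexHull ℝ _ (by simp)
  have hb : b ∈ convexHull ℝ ({a, b, c} : Set ℂ) := subset_convexHull ℝ _ (by simp)
  have hc' : c ∈ convexHull ℝ ({a, b, c} : Set ℂ) := subset_convexHull ℝ _ (by simp)
  have := hc.sum_mem (t := Finset.univ)
    (w := ![cross (c - b) (x - b) / D, -cross (c - a) (x - a) / D, cross (b - a) (x - a) / D])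
    (z := ![a, b, c]) ?_ ?_ ?_
  · rw [hx]
    simpa [Fin.sum_univ_three] using this
  · intro i _
    fin_cases i
    · exact div_nonneg h₂ h.le
    · exact div_nonneg (neg_nonneg.2 h₃) h.le
    · exact div_nonneg h₁ h.le
  · simp only [Fin.sum_univ_three, Matrix.cons_val_zero, Matrix.cons_val_one, Matrix.cons_val]
    field_simp
    linarith
  · intro i _
    fin_cases i <;> simpa

/-- If every edge of an open polygonal path has all other vertices on its left, then all the
triangles formed by vertices in increasing order are positively oriented. -/
lemma cross_pos_of_edges {m : ℕ} {P : ℕ → ℂ}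
    (hP : ∀ i < m, ∀ j ≤ m, j ≠ i → j ≠ i + 1 → 0 < cross (P (i + 1) - P i) (P j - P i))
    {i j k : ℕ} (hij : i < j) (hjk : j < k) (hk : k ≤ m) :
    0 < cross (P j - P i) (P k - P i) := by
  have hcons : ∀ l, i < l → l < m → 0 < cross (P l - P i) (P (l + 1) - P i) := by
    intro l hl hlm
    have := hP l hlm i (by omega) (by omega) (by omega)
    convert this using 1
    simp only [cross_def, sub_re, sub_im]; ring
  have hy : ∀ l, i + 1 < l → l ≤ m → 0 < cross (P (i + 1) - P i) (P l - P i) := fun l hl hlm =>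
    hP i (by omega) l hlm (by omega) (by omega)
  have hy0 : ∀ l, i < l → l ≤ m → 0 ≤ cross (P (i + 1) - P i) (P l - P i) := by
    intro l hl hlm
    rcases Nat.lt_or_ge (i + 1) l with h | h
    · exact (hy l h hlm).le
    · obtain rfl : l = i + 1 := by omega
      simp [cross_def, mul_comm]
  induction k, hjk using Nat.le_induction with
  | base => exact hcons j hij (by omega)
  | succ k hjk ih =>
    have h1 := ih (by omega)
    -- With the first edge vector at `P i` as reference direction, every factor of the Plücker
    -- relation other than the wanted one has a known sign.
    have h2 := cross_mul_cross (P (i + 1) - P i) (P j - P i) (P k - P i) (P (k + 1) - P i)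
    have h3 := hy k (by omega) (by omega)
    have h4 := hy (k + 1) (by omega) hk
    have h5 := hcons k (by omega) (by omega)
    have h6 := hy0 j hij (by omega)
    refine pos_of_mul_pos_left (b := cross (P (i + 1) - P i) (P k - P i)) ?_ h3.le
    rw [h2]
    positivity

/-- A convex polygon, as an intersection of half planes, is covered by the triangles with a common
vertex. -/
lemma exists_mem_fan_triangle {m : ℕ} (hm : 2 ≤ m) {P : ℕ → ℂ}
    (hP : ∀ i j k, i < j → j < k → k ≤ m → 0 < cross (P j - P i) (P k - P i)) {x : ℂ}
    (hx : ∀ i < m, 0 ≤ cross (P (i + 1) - P i) (x - P i))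
    (hx' : 0 ≤ cross (P 0 - P m) (x - P m)) :
    ∃ i, 1 ≤ i ∧ i < m ∧ x ∈ convexHull ℝ {P 0, P i, P (i + 1)} := by
  classical
  have hm' : cross (P m - P 0) (x - P 0) ≤ 0 := by
    have : cross (P 0 - P m) (x - P m) = -cross (P m - P 0) (x - P 0) := by
      simp only [cross_def, sub_re, sub_im]; ring
    linarith
  -- The triangle is found at the first `i ≥ 1` for which the ray from `P 0` to `P (i + 1)` has
  -- reached or passed `x`. Minimality puts `x` to the left of the previous ray; for `i = 1` the
  -- first edge does this.
  have hex : ∃ i, 1 ≤ i ∧ cross (P (i + 1) - P 0) (x - P 0) ≤ 0 :=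
    ⟨m - 1, by omega, by rwa [Nat.sub_add_cancel (by omega)]⟩
  have hle : Nat.find hex ≤ m - 1 :=
    Nat.find_min' hex ⟨by omega, by rwa [Nat.sub_add_cancel (by omega)]⟩
  obtain ⟨h1, h2⟩ := Nat.find_spec hex
  refine ⟨Nat.find hex, h1, by omega, mem_triangle (hP _ _ _ (by omega) (by omega) (by omega)) ?_
    (hx _ (by omega)) h2⟩
  rcases Nat.eq_or_lt_of_le h1 with h | h
  · rw [← h]; exact hx 0 (by omega)
  · by_contra hneg
    refine Nat.find_min hex (m := Nat.find hex - 1) (by omega) ⟨by omega, ?_⟩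
    rw [Nat.sub_add_cancel (by omega)]
    exact (not_le.1 hneg).le

/-! ### Convex polygons: edges, half planes and the fan triangulation -/

section polygon

variable {e : ℕ} {p : Fin e → ℂ}

/-- `side p i x` is nonnegative when `x` is to the left of the `i`-th edge. -/
def side (p : Fin e → ℂ) (i : Fin e) (x : ℂ) : ℝ := cross (p (finRotate e i) - p i) (x - p i)

/-- All vertices which are not on an edge are strictly to the left of this edge. -/
def IsConvexPolygon (p : Fin e → ℂ) : Prop :=
  ∀ i j, j ≠ i → j ≠ finRotate e i → 0 < side p i (p j)

lemma IsRightAngledPolygon.isConvexPolygon {L : ℝ} (hp : IsRightAngledPolygon L p) :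
    IsConvexPolygon p := hp.convex

lemma side_self (i : Fin e) : side p i (p i) = 0 := by simp [side, cross_def]

lemma side_next (i : Fin e) : side p i (p (finRotate e i)) = 0 := by
  simp [side, cross_def, mul_comm]

lemma IsConvexPolygon.side_vertex_nonneg (hp : IsConvexPolygon p) (i j : Fin e) :
    0 ≤ side p i (p j) := by
  by_cases h : j = i
  · rw [h, side_self]
  by_cases h' : j = finRotate e i
  · rw [h', side_next]
  exact (hp i j h h').le

lemma IsConvexPolygon.side_nonneg (hp : IsConvexPolygon p) (i : Fin e) {x : ℂ}
    (hx : x ∈ region p) : 0 ≤ side p i x := by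
  refine (convexHull_min ?_ (convex_cross_nonneg (p (finRotate e i) - p i) (p i))) hx
  rintro _ ⟨j, rfl⟩
  exact hp.side_vertex_nonneg i j

lemma side_sum (i : Fin e) (w : Fin e → ℝ) (hw : ∑ k, w k = 1) :
    side p i (∑ k, w k • p k) = ∑ k, w k * side p i (p k) := by
  have h1 : ∑ k, w k • p k - p i = ∑ k, w k • (p k - p i) := by
    simp only [smul_sub, Finset.sum_sub_distrib, ← Finset.sum_smul, hw, one_smul]
  rw [side, h1, cross, Finset.mul_sum, im_sum]
  refine Finset.sum_congr rfl fun k _ => ?_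
  rw [side, cross, mul_smul_comm, smul_im, smul_eq_mul]

lemma edge_subset_region (i : Fin e) : edge p i ⊆ region p :=
  (convex_convexHull ℝ _).segment_subset (subset_convexHull ℝ _ (mem_range_self _))
    (subset_convexHull ℝ _ (mem_range_self _))

lemma side_eq_zero_of_mem_edge {i : Fin e} {x : ℂ} (hx : x ∈ edge p i) : side p i x = 0 := by
  obtain ⟨s, t, hs, ht, hst, rfl⟩ := hx
  have := cross_sub_combo (p (finRotate e i) - p i) (p i) (p i) (p (finRotate e i)) hst
  rw [side, this, ← side, ← side, side_self, side_next]; simp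

lemma mem_region_iff {x : ℂ} :
    x ∈ region p ↔ ∃ w : Fin e → ℝ, (∀ k, 0 ≤ w k) ∧ ∑ k, w k = 1 ∧ ∑ k, w k • p k = x := by
  constructor
  · intro hx
    refine (convexHull_min (t := {x | ∃ w : Fin e → ℝ, (∀ k, 0 ≤ w k) ∧ ∑ k, w k = 1 ∧
      ∑ k, w k • p k = x}) ?_ ?_) hx
    · rintro _ ⟨j, rfl⟩
      refine ⟨Pi.single j 1, fun k => ?_, ?_, ?_⟩
      · by_cases h : k = j
        · subst h; simp
        · simp [h]
      · simp
      · simp [Pi.single_apply, ite_smul]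
    · rintro _ ⟨w, hw, hw1, rfl⟩ _ ⟨w', hw', hw1', rfl⟩ s t hs ht hst
      refine ⟨fun k => s * w k + t * w' k, fun k => ?_, ?_, ?_⟩
      · have := hw k; have := hw' k; positivity
      · rw [Finset.sum_add_distrib, ← Finset.mul_sum, ← Finset.mul_sum, hw1, hw1']; linarith
      · simp only [add_smul, mul_smul, Finset.sum_add_distrib, Finset.smul_sum]
  · rintro ⟨w, hw, hw1, rfl⟩
    exact (convex_convexHull ℝ _).sum_mem (fun k _ => hw k) hw1
      fun k _ => subset_convexHull ℝ _ (mem_range_self _)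

/-- `side p i` is affine, nonnegative at all vertices and zero only at the ends of the edge, so a
convex combination where it vanishes has weight only on these two. -/
lemma IsConvexPolygon.mem_edge (hp : IsConvexPolygon p) {i : Fin e} {x : ℂ}
    (hx : x ∈ region p) (hi : side p i x = 0) : x ∈ edge p i := by
  obtain ⟨w, hw, hw1, rfl⟩ := mem_region_iff.1 hx
  rw [side_sum i w hw1, Finset.sum_eq_zero_iff_of_nonneg
    fun k _ => mul_nonneg (hw k) (hp.side_vertex_nonneg i k)] at hi
  have h0 : ∀ k, k ≠ i → k ≠ finRotate e i → w k = 0 := fun k h1 h2 =>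
    (mul_eq_zero.1 (hi k (Finset.mem_univ k))).resolve_right (hp i k h1 h2).ne'
  have hsub : ∀ k ∈ (Finset.univ : Finset (Fin e)), w k • p k ≠ 0 → w k ≠ 0 := by
    rintro k - h hk
    exact h (by rw [hk, zero_smul])
  rw [← Finset.sum_filter_of_ne hsub]
  rw [← Finset.sum_filter_ne_zero] at hw1
  refine Convex.sum_mem (convex_segment _ _) (fun k _ => hw k) hw1 fun k hk => ?_
  by_cases h1 : k = i
  · rw [h1]; exact left_mem_segment _ _ _
  by_cases h2 : k = finRotate e i
  · rw [h2]; exact right_mem_segment _ _ _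
  · exact absurd (h0 k h1 h2) (Finset.mem_filter.1 hk).2

lemma finRotate_val (i : Fin e) : (finRotate e i : ℕ) = (i + 1) % e := by
  have := i.neZero
  obtain _ | e := e
  · exact i.elim0
  rw [finRotate_apply, Fin.val_add, Fin.val_one', Nat.add_mod_mod]

lemma finRotate_finRotate_ne (he : 3 ≤ e) (i : Fin e) : finRotate e (finRotate e i) ≠ i := by
  intro h
  have := congrArg Fin.val h
  have hi := i.2
  rw [finRotate_val, finRotate_val] at this
  rcases Nat.lt_or_ge (i + 1) e with h1 | h1
  · rw [Nat.mod_eq_of_lt h1] at this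
    rcases Nat.lt_or_ge (i + 1 + 1) e with h2 | h2
    · rw [Nat.mod_eq_of_lt h2] at this; omega
    · have h3 : (i : ℕ) + 1 + 1 = e := by omega
      rw [h3, Nat.mod_self] at this; omega
  · have h3 : (i : ℕ) + 1 = e := by omega
    rw [h3, Nat.mod_self, Nat.mod_eq_of_lt (by omega)] at this
    omega

/-- Two different edges have at most a vertex in common. -/
lemma IsConvexPolygon.mem_range_of_mem_edges (he : 3 ≤ e) (hp : IsConvexPolygon p) {i k : Fin e}
    (hik : i ≠ k) {x : ℂ} (hi : x ∈ edge p i) (hk : x ∈ edge p k) : x ∈ range p := by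
  have h0 := side_eq_zero_of_mem_edge hk
  obtain ⟨s, t, hs, ht, hst, rfl⟩ := hi
  rcases hs.eq_or_lt with rfl | hs'
  · obtain rfl : t = 1 := by linarith
    exact ⟨finRotate e i, by simp⟩
  rcases ht.eq_or_lt with rfl | ht'
  · obtain rfl : s = 1 := by linarith
    exact ⟨i, by simp⟩
  rw [side, cross_sub_combo _ _ _ _ hst, ← side, ← side] at h0
  have h1 := hp.side_vertex_nonneg k i
  have h2 := hp.side_vertex_nonneg k (finRotate e i)
  -- A common point interior to edge `i` forces both ends of that edge onto the line of edge `k`.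
  -- Then the two edges have the same ends in opposite order, which would make two rotation steps
  -- the identity.
  have h3 : side p k (p i) = 0 := by nlinarith [mul_nonneg hs h1, mul_nonneg ht h2]
  have h4 : side p k (p (finRotate e i)) = 0 := by nlinarith [mul_nonneg hs h1, mul_nonneg ht h2]
  have h5 : i = finRotate e k := by
    by_contra h
    exact (hp k i hik h).ne' h3
  have h6 : finRotate e i = k := by
    by_contra h
    refine (hp k (finRotate e i) h fun h' => hik ?_).ne' h4
    exact (finRotate e).injective h'
  exact absurd (by rw [← h5, h6]) (finRotate_finRotate_ne he k)

/-- The vertices of a polygon as a periodic sequence. -/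
def vertexSeq (he : 0 < e) (p : Fin e → ℂ) (k : ℕ) : ℂ := p ⟨k % e, Nat.mod_lt k he⟩

lemma vertexSeq_val (he : 0 < e) (i : Fin e) : vertexSeq he p i = p i := by
  simp only [vertexSeq, Nat.mod_eq_of_lt i.2]

lemma vertexSeq_succ (he : 0 < e) (i : Fin e) :
    vertexSeq he p (i + 1) = p (finRotate e i) := by
  rw [vertexSeq]; congr 1; ext; rw [finRotate_val]

lemma side_eq_vertexSeq (he : 0 < e) (i : Fin e) (x : ℂ) :
    side p i x = cross (vertexSeq he p (i + 1) - vertexSeq he p i) (x - vertexSeq he p i) := by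
  rw [vertexSeq_succ, vertexSeq_val, side]

lemma IsConvexPolygon.cross_vertexSeq_pos {m : ℕ} {p : Fin (m + 1) → ℂ} (hp : IsConvexPolygon p)
    {i j k : ℕ} (hij : i < j) (hjk : j < k) (hk : k ≤ m) :
    0 < cross (vertexSeq m.succ_pos p j - vertexSeq m.succ_pos p i)
      (vertexSeq m.succ_pos p k - vertexSeq m.succ_pos p i) := by
  refine cross_pos_of_edges (m := m) (P := vertexSeq m.succ_pos p) ?_ hij hjk hk
  intro i hi j hj h1 h2
  have := hp ⟨i, by omega⟩ ⟨j, by omega⟩ (by simpa [Fin.ext_iff]) (by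
    rw [Ne, Fin.ext_iff, finRotate_val]
    simpa [Nat.mod_eq_of_lt (show i + 1 < m + 1 by omega)])
  rw [side_eq_vertexSeq m.succ_pos] at this
  rwa [← vertexSeq_val (p := p) m.succ_pos] at this

/-- A convex polygon is the union of the triangles with apex at its first vertex, and the
intersection of the half planes to the left of its edges. -/
lemma IsConvexPolygon.region_eq {m : ℕ} (hm : 2 ≤ m) {p : Fin (m + 1) → ℂ}
    (hp : IsConvexPolygon p) :
    region p = ⋃ i ∈ Finset.Ico 1 m, convexHull ℝ {vertexSeq m.succ_pos p 0,
      vertexSeq m.succ_pos p i, vertexSeq m.succ_pos p (i + 1)} ∧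
    region p = {x | ∀ i, 0 ≤ side p i x} := by
  have h1 : region p ⊆ {x | ∀ i, 0 ≤ side p i x} := fun x hx i => hp.side_nonneg i hx
  have h2 : {x | ∀ i, 0 ≤ side p i x} ⊆ ⋃ i ∈ Finset.Ico 1 m, convexHull ℝ
      {vertexSeq m.succ_pos p 0, vertexSeq m.succ_pos p i, vertexSeq m.succ_pos p (i + 1)} := by
    intro x hx
    obtain ⟨i, hi, him, hxi⟩ := exists_mem_fan_triangle hm (P := vertexSeq m.succ_pos p)
      (fun i j k hij hjk hk => hp.cross_vertexSeq_pos hij hjk hk) (x := x)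
      (fun i hi => by
        have := hx ⟨i, by omega⟩
        rwa [side_eq_vertexSeq m.succ_pos] at this)
      (by
        have := hx ⟨m, by omega⟩
        rw [side_eq_vertexSeq m.succ_pos] at this
        have h0 : vertexSeq m.succ_pos p (m + 1) = vertexSeq m.succ_pos p 0 := by
          simp [vertexSeq]
        simpa only [h0] using this)
    simp only [mem_iUnion, Finset.mem_Ico]
    exact ⟨i, ⟨hi, him⟩, hxi⟩
  have h3 : (⋃ i ∈ Finset.Ico 1 m, convexHull ℝ {vertexSeq m.succ_pos p 0,
      vertexSeq m.succ_pos p i, vertexSeq m.succ_pos p (i + 1)}) ⊆ region p := by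
    refine iUnion₂_subset fun i _ => convexHull_mono ?_
    rintro x (rfl | rfl | rfl) <;> exact mem_range_self _
  exact ⟨(h1.trans h2).antisymm h3, h1.antisymm (h2.trans h3)⟩

end polygon

/-! ### The area of a geodesic triangle -/

/-- `1 - ‖x‖ ^ 2` in coordinates. -/
def gap (x : ℂ) : ℝ := 1 - (x.re * x.re + x.im * x.im)

/-- The Euclidean scalar product in coordinates. -/
def dot (u v : ℂ) : ℝ := u.re * v.re + u.im * v.im

lemma gap_eq (x : ℂ) : 1 - ‖x‖ ^ 2 = gap x := by
  rw [gap, Complex.sq_norm, Complex.normSq_apply]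

lemma inner_eq_dot (u v : ℂ) : inner ℝ u v = dot u v := by
  simp [Complex.inner, dot]; ring

lemma gap_pos {x : ℂ} (hx : ‖x‖ < 1) : 0 < gap x := by
  rw [← gap_eq]; nlinarith [norm_nonneg x]

lemma continuous_gap : Continuous gap := by unfold gap; fun_prop

lemma metric_eq (L : ℝ) (x v w : ℂ) :
    metric L x v w = L ^ 2 * (dot v w / gap x + dot x v * dot x w / gap x ^ 2) := by
  simp only [metric, inner_eq_dot, gap_eq]

/-- The area density at radius one. -/
def density (x : ℂ) : ℝ := 1 / (gap x * √(gap x))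

lemma density_nonneg {x : ℂ} (hx : ‖x‖ < 1) : 0 ≤ density x := by
  have := gap_pos hx
  unfold density; positivity

lemma sqrt_det_metric (L : ℝ) {x : ℂ} (hx : ‖x‖ < 1) :
    √(metric L x 1 1 * metric L x I I - metric L x 1 I ^ 2) = L ^ 2 * density x := by
  have hq := gap_pos hx
  have h : metric L x 1 1 * metric L x I I - metric L x 1 I ^ 2 = (L ^ 2) ^ 2 / gap x ^ 3 := by
    simp only [metric_eq]
    have h1 : x.re * x.re + x.im * x.im = 1 - gap x := by unfold gap; ring
    simp only [dot, one_re, one_im, I_re, I_im]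
    field_simp
    linear_combination L ^ 4 * gap x * h1
  rw [h, Real.sqrt_div (by positivity), Real.sqrt_sq (by positivity), density,
    show gap x ^ 3 = gap x ^ 2 * gap x by ring, Real.sqrt_mul (by positivity),
    Real.sqrt_sq hq.le]
  ring

lemma continuousOn_density : ContinuousOn density {x | ‖x‖ < 1} := by
  unfold density
  refine ContinuousOn.div continuousOn_const
    (continuous_gap.mul continuous_gap.sqrt).continuousOn fun x hx => ?_
  have := gap_pos hx
  positivity

/-- A complex number whose argument is the angle from `u` to `v` in the tangent space at `x`. -/
def angleForm (x u v : ℂ) : ℂ :=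
  -- Real and imaginary parts are `gap x ^ 2` times the radius-one metric and its area form; the
  -- common positive factor does not affect the argument.
  ⟨gap x * dot u v + dot x u * dot x v, √(gap x) * cross u v⟩

/-- The angle from `u` to `v` in the tangent space at `x`. -/
def hypAngle (x u v : ℂ) : ℝ := (angleForm x u v).arg

lemma arg_eq_pi_div_two_sub_arctan {z : ℂ} (hz : 0 < z.im) :
    z.arg = Real.pi / 2 - Real.arctan (z.re / z.im) := by
  set h := z.re / z.im with hh
  have h1 : 0 < √(1 + h ^ 2) := by positivity
  have hz' : z = ((z.im * √(1 + h ^ 2) : ℝ) : ℂ) *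
      (Complex.cos (Real.pi / 2 - Real.arctan h : ℝ) +
        Complex.sin (Real.pi / 2 - Real.arctan h : ℝ) * I) := by
    rw [← ofReal_cos, ← ofReal_sin, Real.cos_pi_div_two_sub, Real.sin_pi_div_two_sub,
      Real.sin_arctan, Real.cos_arctan]
    apply Complex.ext
    · rw [re_ofReal_mul]
      simp only [add_re, ofReal_re, mul_re, I_re, I_im, ofReal_im]
      field_simp
      rw [hh]; field_simp; ring
    · rw [im_ofReal_mul]
      simp only [add_im, ofReal_re, mul_im, I_re, I_im, ofReal_im]
      field_simp; ring
  rw [hz', Complex.arg_mul_cos_add_sin_mul_I (by positivity)]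
  have := Real.neg_pi_div_two_lt_arctan h
  have := Real.arctan_lt_pi_div_two h
  constructor <;> linarith

lemma hypAngle_eq {x u v : ℂ} (hx : 0 < gap x) (h : 0 < cross u v) :
    hypAngle x u v = Real.pi / 2 - Real.arctan
      ((gap x * dot u v + dot x u * dot x v) / (√(gap x) * cross u v)) :=
  arg_eq_pi_div_two_sub_arctan (z := angleForm x u v)
    (mul_pos (Real.sqrt_pos.2 hx) h)

/-- Angles with positive orientation add up. -/
lemma hypAngle_add {x u v w : ℂ} (hx : 0 < gap x) (huv : 0 < cross u v) (hvw : 0 < cross v w)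
    (huw : 0 < cross u w) : hypAngle x u v + hypAngle x v w = hypAngle x u w := by
  have hs := Real.sqrt_pos.2 hx
  have hss : √(gap x) ^ 2 = gap x := Real.sq_sqrt hx.le
  have hprod : angleForm x u v * angleForm x v w =
      ((gap x * dot v v + dot x v * dot x v : ℝ) : ℂ) * angleForm x u w := by
    apply Complex.ext
    · rw [re_ofReal_mul]
      simp only [angleForm, mul_re]
      have : √(gap x) * cross u v * (√(gap x) * cross v w) = gap x * cross u v * cross v w := by
        rw [mul_mul_mul_comm, ← sq, hss]; ring
      rw [this]
      simp only [gap, dot, cross_def]; ring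
    · rw [im_ofReal_mul]
      simp only [angleForm, mul_im]
      simp only [dot, cross_def]; ring
  have him : ∀ {a b : ℂ}, 0 < cross a b → 0 < (angleForm x a b).im := fun h => mul_pos hs h
  have hv : v ≠ 0 := by
    rintro rfl; simp [cross_def] at huv
  have hpos : 0 < gap x * dot v v + dot x v * dot x v := by
    have : 0 < dot v v := by
      have := Complex.normSq_pos.2 hv
      rwa [Complex.normSq_apply] at this
    have := mul_self_nonneg (dot x v)
    positivity
  have harg := congrArg Complex.arg hprod
  rw [Complex.arg_real_mul _ hpos] at harg
  have hne : ∀ {a b : ℂ}, 0 < cross a b → angleForm x a b ≠ 0 := fun h h0 => by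
    have := him h; rw [h0] at this; simp at this
  have hlt : ∀ {a b : ℂ}, 0 < cross a b → 0 < hypAngle x a b ∧ hypAngle x a b < Real.pi := by
    intro a b h
    rw [hypAngle_eq hx h]
    have := Real.neg_pi_div_two_lt_arctan
      ((gap x * dot a b + dot x a * dot x b) / (√(gap x) * cross a b))
    have := Real.arctan_lt_pi_div_two
      ((gap x * dot a b + dot x a * dot x b) / (√(gap x) * cross a b))
    constructor <;> linarith
  have h1 := hlt huv
  have h2 := hlt hvw
  have h3 := hlt huw
  have hcoe := Complex.arg_mul_coe_angle (hne huv) (hne hvw)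
  rw [harg, ← Real.Angle.coe_add, Real.Angle.angle_eq_iff_two_pi_dvd_sub] at hcoe
  obtain ⟨k, hk⟩ := hcoe
  simp only [hypAngle] at *
  -- The arguments add up modulo `2 * π`, and all three lie in `(0, π)`.
  have hk0 : k = 0 := by
    have hpi := Real.pi_pos
    have hk1 : (-1 : ℝ) < k := by nlinarith
    have hk2 : (k : ℝ) < 1 := by nlinarith
    have : (-1 : ℤ) < k := by exact_mod_cast hk1
    have : k < (1 : ℤ) := by exact_mod_cast hk2
    omega
  rw [hk0] at hk
  simp at hk
  linarith

/-- The derivative of an angle whose cotangent is `N / (√q * K)`. -/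
lemma hasDerivAt_angle {N q : ℝ → ℝ} {N' q' K E D c τ : ℝ} (hN : HasDerivAt N N' τ)
    (hq : HasDerivAt q q' τ) (hq0 : 0 < q τ) (hK : 0 < K) (hE : 0 < E) (hD : 0 < D)
    (h1 : N' * q τ - N τ * q' / 2 = -(c * E)) (h2 : K ^ 2 * q τ + N τ ^ 2 = E * D) :
    HasDerivAt (fun τ => Real.pi / 2 - Real.arctan (N τ / (√(q τ) * K)))
      (c * K / (√(q τ) * D)) τ := by
  have hs : HasDerivAt (fun τ => √(q τ)) (q' / (2 * √(q τ))) τ := hq.sqrt hq0.ne'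
  have hr := Real.sqrt_pos.2 hq0
  have hrr : √(q τ) ^ 2 = q τ := Real.sq_sqrt hq0.le
  have := ((hN.div (hs.mul_const K) (by positivity)).arctan).const_sub (Real.pi / 2)
  refine this.congr_deriv ?_
  simp only [Pi.div_apply]
  set r := √(q τ) with hrdef
  -- `h2` is a Lagrange identity: it factors one plus the squared cotangent so that `E` cancels
  -- against the `E` in `h1`.
  have h3 : 1 + (N τ / (r * K)) ^ 2 = E * D / (r ^ 2 * K ^ 2) := by
    rw [← h2, ← hrr]; field_simp
  have h4 : (N' * (r * K) - N τ * (q' / (2 * r) * K)) / (r * K) ^ 2 = -(c * E) / (r ^ 3 * K) := by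
    rw [← h1, ← hrr]; field_simp
  rw [h3, h4]
  field_simp

/-- The radial integral of the area density. -/
lemma integral_radial {c b g : ℝ} (hc : 0 < c) (hD : 0 < g * c + b ^ 2)
    (hq : ∀ s ∈ Icc (0 : ℝ) 1, 0 < c - 2 * b * s - g * s ^ 2) :
    ∫ s in (0 : ℝ)..1, s / ((c - 2 * b * s - g * s ^ 2) * √(c - 2 * b * s - g * s ^ 2)) =
      (c - b) / (√(c - 2 * b - g) * (g * c + b ^ 2)) - √c / (g * c + b ^ 2) := by
  -- The quadratic is the gap along a segment issuing from a vertex, with `c` its value there; `g *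
  -- c + b ^ 2` is a quarter of its discriminant.
  have hder : ∀ s ∈ uIcc (0 : ℝ) 1, HasDerivAt
      (fun s => (c - b * s) / (√(c - 2 * b * s - g * s ^ 2) * (g * c + b ^ 2)))
      (s / ((c - 2 * b * s - g * s ^ 2) * √(c - 2 * b * s - g * s ^ 2))) s := by
    intro s hs
    rw [uIcc_of_le zero_le_one] at hs
    have hq0 := hq s hs
    have hqd : HasDerivAt (fun s => c - 2 * b * s - g * s ^ 2) (-2 * b - g * (2 * s)) s := by
      have := (((hasDerivAt_id s).const_mul (2 * b)).const_sub c).sub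
        (((hasDerivAt_id s).pow 2).const_mul g)
      refine this.congr_deriv ?_
      simp
    have hsq := hqd.sqrt hq0.ne'
    have hn : HasDerivAt (fun s => c - b * s) (-b) s := by
      simpa using ((hasDerivAt_id s).const_mul b).const_sub c
    have := hn.div (hsq.mul_const (g * c + b ^ 2)) (by have := Real.sqrt_pos.2 hq0; positivity)
    refine this.congr_deriv ?_
    have hr := Real.sqrt_pos.2 hq0
    have hrr : √(c - 2 * b * s - g * s ^ 2) ^ 2 = c - 2 * b * s - g * s ^ 2 := Real.sq_sqrt hq0.le
    set r := √(c - 2 * b * s - g * s ^ 2) with hrdef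
    rw [← hrr]
    field_simp
    rw [hrr]; ring
  rw [intervalIntegral.integral_eq_sub_of_hasDerivAt hder]
  · have hr := Real.sqrt_pos.2 hc
    have hrr : √c ^ 2 = c := Real.sq_sqrt hc.le
    simp only [mul_one, mul_zero, sub_zero, one_pow]
    congr 1
    · simp only [ne_eq, OfNat.ofNat_ne_zero, not_false_eq_true, zero_pow, mul_zero, sub_zero]
      rw [div_eq_div_iff (by positivity) (by positivity)]
      nlinarith
  · refine ContinuousOn.intervalIntegrable ?_
    rw [uIcc_of_le zero_le_one]
    refine ContinuousOn.div (by fun_prop) (by fun_prop) fun s hs => ?_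
    have := hq s hs
    positivity

/-- Parametrization of the triangle with apex `a` by the position `τ` on the opposite edge and the
relative distance `s` to the apex. -/
def triangleMap (a b c : ℂ) (z : ℝ × ℝ) : ℂ := a + z.2 • (b - a + z.1 • (c - b))

lemma triangle_eq_image (a b c : ℂ) :
    convexHull ℝ {a, b, c} = triangleMap a b c '' (Icc 0 1 ×ˢ Icc 0 1) := by
  rw [convexHull_insert (by simp), convexHull_pair, convexJoin_singleton_left]
  ext x
  simp only [mem_iUnion, segment_eq_image', mem_image, exists_prop, mem_prod, Prod.exists,
    triangleMap]
  constructor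
  · rintro ⟨_, ⟨τ, hτ, rfl⟩, s, hs, rfl⟩
    exact ⟨τ, s, ⟨hτ, hs⟩, by congr 2; ring⟩
  · rintro ⟨τ, s, ⟨hτ, hs⟩, rfl⟩
    exact ⟨_, ⟨τ, hτ, rfl⟩, s, hs, by congr 2; ring⟩

/-- The value `s = 0` is excluded because there all `τ` give the apex. For `s > 0`, the cross
product with `c - b` recovers `s`, and the one with `b - a` then recovers `τ`. -/
lemma triangleMap_injOn {a b c : ℂ} (h : 0 < cross (b - a) (c - a)) :
    InjOn (triangleMap a b c) (Icc 0 1 ×ˢ Ioc 0 1) := by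
  rintro ⟨τ, s⟩ ⟨-, hs⟩ ⟨τ', s'⟩ ⟨-, hs'⟩ heq
  simp only [triangleMap, add_right_inj] at heq
  have e1 := congrArg Complex.re heq
  have e2 := congrArg Complex.im heq
  simp only [real_smul, re_ofReal_mul, im_ofReal_mul, add_re, add_im, sub_re, sub_im] at e1 e2
  simp only [cross_def, sub_re, sub_im] at h
  have h1 : s = s' := by
    have : (s - s') * ((b.re - a.re) * (c.im - a.im) - (b.im - a.im) * (c.re - a.re)) = 0 := by
      linear_combination (c.im - b.im) * e1 - (c.re - b.re) * e2
    rcases mul_eq_zero.1 this with h' | h'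
    · linarith
    · exact absurd h' h.ne'
  subst h1
  have h2 : τ = τ' := by
    have : s * ((τ - τ') * ((b.re - a.re) * (c.im - a.im) - (b.im - a.im) * (c.re - a.re))) = 0 := by
      linear_combination (b.re - a.re) * e2 - (b.im - a.im) * e1
    rcases mul_eq_zero.1 this with h' | h'
    · exact absurd h' hs.1.ne'
    rcases mul_eq_zero.1 h' with h' | h'
    · linarith
    · exact absurd h' h.ne'
  rw [h2]

lemma continuous_triangleMap (a b c : ℂ) : Continuous (triangleMap a b c) := by
  unfold triangleMap; fun_prop

/-- Integration over a triangle in the coordinates of `triangleMap`. -/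
lemma integral_triangle {a b c : ℂ} (h : 0 < cross (b - a) (c - a)) {f : ℂ → ℝ}
    (hf : ContinuousOn f (convexHull ℝ {a, b, c})) :
    ∫ x in convexHull ℝ {a, b, c}, f x =
      ∫ τ in (0 : ℝ)..1, ∫ s in (0 : ℝ)..1,
        cross (b - a) (c - a) * s * f (triangleMap a b c (τ, s)) := by
  set K := cross (b - a) (c - a) with hK
  set T := convexHull ℝ ({a, b, c} : Set ℂ) with hT
  set ψ : ℝ × ℝ → ℝ × ℝ := fun z => ((triangleMap a b c z).re, (triangleMap a b c z).im) with hψ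
  set S : Set (ℝ × ℝ) := Icc 0 1 ×ˢ Ioc 0 1 with hS
  have hSm : MeasurableSet S := measurableSet_Icc.prod measurableSet_Ioc
  have hTS : T =ᵐ[volume] triangleMap a b c '' S := by
    have hsub : triangleMap a b c '' S ⊆ T := by
      rw [hT, triangle_eq_image]
      exact image_mono (prod_mono subset_rfl Ioc_subset_Icc_self)
    refine (ae_eq_set.2 ⟨?_, ?_⟩)
    · refine measure_mono_null (t := {a}) ?_ (measure_singleton a)
      rintro x ⟨hx, hx'⟩
      rw [hT, triangle_eq_image] at hx
      obtain ⟨⟨τ, s⟩, ⟨hτ, hs⟩, rfl⟩ := hx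
      rcases hs.1.eq_or_lt with h0 | h0
      · simp only at h0
        simp [triangleMap, ← h0]
      · exact absurd ⟨(τ, s), ⟨hτ, h0, hs.2⟩, rfl⟩ hx'
    · rw [sdiff_eq_empty.2 hsub, measure_empty]
  rw [setIntegral_congr_set hTS]
  have hpre : triangleMap a b c '' S = Complex.measurableEquivRealProd ⁻¹' (ψ '' S) := by
    ext x
    simp only [mem_image, mem_preimage, measurableEquivRealProd_apply, hψ, Prod.mk.injEq]
    exact exists_congr fun z => and_congr_right fun _ => Complex.ext_iff
  have hintegral := Complex.volume_preserving_equiv_real_prod.setIntegral_preimage_emb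
    Complex.measurableEquivRealProd.measurableEmbedding
    (fun y => f (Complex.measurableEquivRealProd.symm y)) (ψ '' S)
  simp only [MeasurableEquiv.symm_apply_apply] at hintegral
  rw [hpre, hintegral]
  set M : ℝ × ℝ → (ℝ × ℝ →L[ℝ] ℝ × ℝ) := fun z => LinearMap.toContinuousLinearMap
    (Matrix.toLin (Module.Basis.finTwoProd ℝ) (Module.Basis.finTwoProd ℝ)
      !![z.2 * (c - b).re, (b - a).re + z.1 * (c - b).re;
        z.2 * (c - b).im, (b - a).im + z.1 * (c - b).im]) with hM
  have hder : ∀ z ∈ S, HasFDerivWithinAt ψ (M z) S z := by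
    intro z _
    refine HasFDerivAt.hasFDerivWithinAt ?_
    rw [hM]
    simp only [Matrix.toLin_finTwoProd_toContinuousLinearMap]
    have h1 : HasFDerivAt (fun z : ℝ × ℝ => z.1) (ContinuousLinearMap.fst ℝ ℝ ℝ) z :=
      hasFDerivAt_fst
    have h2 : HasFDerivAt (fun z : ℝ × ℝ => z.2) (ContinuousLinearMap.snd ℝ ℝ ℝ) z :=
      hasFDerivAt_snd
    have key : ∀ a₀ u₀ d₀ : ℝ, HasFDerivAt (fun z : ℝ × ℝ => a₀ + z.2 * (u₀ + z.1 * d₀))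
        ((z.2 * d₀) • ContinuousLinearMap.fst ℝ ℝ ℝ +
          (u₀ + z.1 * d₀) • ContinuousLinearMap.snd ℝ ℝ ℝ) z := by
      intro a₀ u₀ d₀
      refine ((h2.mul ((h1.mul_const d₀).const_add u₀)).const_add a₀).congr_fderiv ?_
      ext <;> simp
    have e : ψ = fun z : ℝ × ℝ => (a.re + z.2 * ((b - a).re + z.1 * (c - b).re),
        a.im + z.2 * ((b - a).im + z.1 * (c - b).im)) := by
      funext z
      simp [hψ, triangleMap, mul_add]
    rw [e]
    exact (key _ _ _).prodMk (key _ _ _)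
  have hinj : InjOn ψ S := by
    intro z hz z' hz' hzz
    refine triangleMap_injOn h hz hz' ?_
    simp only [hψ, Prod.mk.injEq] at hzz
    exact Complex.ext hzz.1 hzz.2
  rw [integral_image_eq_integral_abs_det_fderiv_smul volume hSm hder hinj]
  have hval : ∀ z ∈ S, |(M z).det| • f (Complex.measurableEquivRealProd.symm (ψ z)) =
      K * z.2 * f (triangleMap a b c z) := by
    intro z hz
    have hdet : (M z).det = -(K * z.2) := by
      rw [hM]
      simp only [LinearMap.det_toContinuousLinearMap, LinearMap.det_toLin, Matrix.det_fin_two_of]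
      simp only [hK, cross_def, sub_re, sub_im]; ring
    have hz2 : 0 < z.2 := hz.2.1
    rw [hdet, abs_neg, abs_of_pos (by positivity), smul_eq_mul]
    rfl
  rw [setIntegral_congr_fun hSm hval]
  have hcont : ContinuousOn (fun z : ℝ × ℝ => K * z.2 * f (triangleMap a b c z))
      (Icc 0 1 ×ˢ Icc 0 1) := by
    refine ContinuousOn.mul (by fun_prop) (hf.comp (continuous_triangleMap a b c).continuousOn ?_)
    intro z hz
    rw [hT, triangle_eq_image]
    exact mem_image_of_mem _ hz
  have hio : IntegrableOn (fun z : ℝ × ℝ => K * z.2 * f (triangleMap a b c z)) S :=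
    (hcont.integrableOn_compact (isCompact_Icc.prod isCompact_Icc)).mono_set
      (prod_mono subset_rfl Ioc_subset_Icc_self)
  rw [hS, Measure.volume_eq_prod, setIntegral_prod _ (by rwa [← Measure.volume_eq_prod]),
    integral_Icc_eq_integral_Ioc, intervalIntegral.integral_of_le zero_le_one]
  refine setIntegral_congr_fun measurableSet_Ioc fun τ _ => ?_
  simp only [intervalIntegral.integral_of_le zero_le_one]

lemma norm_lt_one_of_mem_convexHull {s : Set ℂ} (hs : ∀ x ∈ s, ‖x‖ < 1) {x : ℂ}
    (hx : x ∈ convexHull ℝ s) : ‖x‖ < 1 := by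
  have := convexHull_min (t := Metric.ball (0 : ℂ) 1) (fun y hy => by simpa using hs y hy)
    (convex_ball 0 1) hx
  simpa using this

/-- The area of a hyperbolic triangle is its angular defect. -/
lemma integral_density_triangle {a b c : ℂ} (ha : ‖a‖ < 1) (hb : ‖b‖ < 1) (hc : ‖c‖ < 1)
    (h : 0 < cross (b - a) (c - a)) :
    ∫ x in convexHull ℝ {a, b, c}, density x =
      Real.pi - hypAngle a (b - a) (c - a) - hypAngle b (c - b) (a - b)
        - hypAngle c (a - c) (b - c) := by
  have hT : ∀ x ∈ convexHull ℝ ({a, b, c} : Set ℂ), ‖x‖ < 1 := fun x hx =>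
    norm_lt_one_of_mem_convexHull (s := {a, b, c}) (by rintro x (rfl | rfl | rfl) <;> assumption) hx
  have hmem : ∀ τ ∈ Icc (0 : ℝ) 1, ∀ s ∈ Icc (0 : ℝ) 1,
      0 < gap (triangleMap a b c (τ, s)) := fun τ hτ s hs => gap_pos (hT _ (by
    rw [triangle_eq_image]; exact mem_image_of_mem _ ⟨hτ, hs⟩))
  rw [integral_triangle h (continuousOn_density.mono hT)]
  set K := cross (b - a) (c - a) with hK
  set d := c - b with hd
  have hqa := gap_pos ha
  -- the point on the edge opposite to `a`, and its position relative to `a`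
  set X : ℝ → ℂ := fun τ => b + τ • d with hX
  have hXg : ∀ τ ∈ Icc (0 : ℝ) 1, 0 < gap (X τ) := by
    intro τ hτ
    have := hmem τ hτ 1 (by simp)
    have e : triangleMap a b c (τ, 1) = X τ := by simp [triangleMap, hX, hd]; ring
    rwa [e] at this
  -- This is `gap a ^ 2` times the squared radius-one length of `X τ - a` in the tangent space at
  -- `a`, and also the discriminant term of the radial integral.
  set D : ℝ → ℝ := fun τ => dot (X τ - a) (X τ - a) * gap a + dot a (X τ - a) ^ 2 with hDdef
  have hcross : ∀ τ, cross (X τ - a) d = K := by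
    intro τ
    simp only [hX, hK, hd, cross_def, sub_re, sub_im, add_re, add_im, real_smul, re_ofReal_mul,
      im_ofReal_mul]
    ring
  have hD : ∀ τ, 0 < D τ := by
    intro τ
    have hne : X τ - a ≠ 0 := by
      intro h0
      have := hcross τ
      rw [h0] at this
      simp [cross_def] at this
      linarith
    have h1 : 0 < dot (X τ - a) (X τ - a) := by
      have := Complex.normSq_pos.2 hne
      rwa [Complex.normSq_apply] at this
    have := sq_nonneg (dot a (X τ - a))
    simp only [hDdef]; positivity
  have hd0 : 0 < dot d d := by
    have hne : d ≠ 0 := by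
      intro h0
      have := hcross 0
      rw [h0] at this
      simp [cross_def] at this
      linarith
    have := Complex.normSq_pos.2 hne
    rwa [Complex.normSq_apply] at this
  -- The radial integral leaves two terms, which turn out to be the derivatives of the angle at `X
  -- τ` and of an angle at `a`.
  have hinner : ∀ τ ∈ Icc (0 : ℝ) 1,
      ∫ s in (0 : ℝ)..1, K * s * density (triangleMap a b c (τ, s)) =
        (1 - dot a (X τ)) * K / (√(gap (X τ)) * D τ) - √(gap a) * K / D τ := by
    intro τ hτ
    have hg : ∀ s, gap (triangleMap a b c (τ, s)) =
        gap a - 2 * dot a (X τ - a) * s - dot (X τ - a) (X τ - a) * s ^ 2 := by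
      intro s
      simp only [hX, hd, triangleMap, gap, dot, sub_re, sub_im, add_re, add_im, real_smul,
        re_ofReal_mul, im_ofReal_mul]
      ring
    have hrad := integral_radial (c := gap a) (b := dot a (X τ - a)) (g := dot (X τ - a) (X τ - a))
      hqa (hD τ) (fun s hs => by rw [← hg]; exact hmem τ hτ s hs)
    have e1 : gap a - 2 * dot a (X τ - a) - dot (X τ - a) (X τ - a) = gap (X τ) := by
      simp only [gap, dot, sub_re, sub_im]; ring
    have e2 : gap a - dot a (X τ - a) = 1 - dot a (X τ) := by
      simp only [gap, dot, sub_re, sub_im]; ring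
    rw [e1, e2] at hrad
    have e3 : ∀ s, K * s * density (triangleMap a b c (τ, s)) = K *
        (s / ((gap a - 2 * dot a (X τ - a) * s - dot (X τ - a) (X τ - a) * s ^ 2) *
          √(gap a - 2 * dot a (X τ - a) * s - dot (X τ - a) (X τ - a) * s ^ 2))) := by
      intro s; rw [density, hg]; ring
    simp only [e3]
    rw [intervalIntegral.integral_const_mul, hrad]
    ring
  have hXre : ∀ τ, HasDerivAt (fun τ => (X τ).re) d.re τ := by
    intro τ
    have : (fun τ => (X τ).re) = fun τ => b.re + τ * d.re := by funext τ; simp [hX]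
    rw [this]
    simpa using ((hasDerivAt_id τ).mul_const d.re).const_add b.re
  have hXim : ∀ τ, HasDerivAt (fun τ => (X τ).im) d.im τ := by
    intro τ
    have : (fun τ => (X τ).im) = fun τ => b.im + τ * d.im := by funext τ; simp [hX]
    rw [this]
    simpa using ((hasDerivAt_id τ).mul_const d.im).const_add b.im
  -- the angle at the moving point
  have hφ : ∀ τ ∈ Icc (0 : ℝ) 1, HasDerivAt (fun τ => Real.pi / 2 - Real.arctan
      ((gap (X τ) * dot d a - dot d (X τ) * (1 - dot (X τ) a)) / (√(gap (X τ)) * K)))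
      ((1 - dot a (X τ)) * K / (√(gap (X τ)) * D τ)) τ := by
    intro τ hτ
    have hg' : HasDerivAt (fun τ => gap (X τ)) (-2 * dot (X τ) d) τ := by
      have := (((hXre τ).mul (hXre τ)).add ((hXim τ).mul (hXim τ))).const_sub 1
      refine this.congr_deriv ?_
      simp only [dot]; ring
    have hda : HasDerivAt (fun τ => dot d (X τ)) (dot d d) τ :=
      ((hXre τ).const_mul d.re).add ((hXim τ).const_mul d.im)
    have hXa : HasDerivAt (fun τ => dot (X τ) a) (dot d a) τ :=
      ((hXre τ).mul_const a.re).add ((hXim τ).mul_const a.im)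
    have hN := (hg'.mul_const (dot d a)).sub (hda.mul (hXa.const_sub 1))
    have hKτ := hcross τ
    refine hasDerivAt_angle (E := gap (X τ) * dot d d + dot (X τ) d ^ 2) hN hg' (hXg τ hτ) h ?_
      (hD τ) ?_ ?_
    · have := hXg τ hτ
      positivity
    · simp only [gap, dot]; ring
    · rw [← hKτ]
      simp only [hDdef, gap, dot, cross_def, sub_re, sub_im]; ring
  -- the angle at the apex
  have hψ : ∀ τ ∈ Icc (0 : ℝ) 1, HasDerivAt (fun τ => Real.pi / 2 - Real.arctan
      ((gap a * dot (X τ - a) d + dot a (X τ - a) * dot a d) / (√(gap a) * K)))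
      (-(√(gap a) * K / D τ)) τ := by
    intro τ hτ
    have hda : HasDerivAt (fun τ => dot (X τ - a) d) (dot d d) τ :=
      (((hXre τ).sub_const a.re).mul_const d.re).add (((hXim τ).sub_const a.im).mul_const d.im)
    have hXa : HasDerivAt (fun τ => dot a (X τ - a)) (dot a d) τ :=
      (((hXre τ).sub_const a.re).const_mul a.re).add (((hXim τ).sub_const a.im).const_mul a.im)
    have hN := (hda.const_mul (gap a)).add (hXa.mul_const (dot a d))
    have hKτ := hcross τ
    have := hasDerivAt_angle (q := fun _ => gap a) (K := K) (c := -gap a) (D := D τ)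
      (E := gap a * dot d d + dot a d ^ 2) hN (hasDerivAt_const τ _) hqa h (by positivity) (hD τ)
      (by ring) (by
        rw [← hKτ]
        simp only [hDdef, gap, dot, cross_def, Pi.add_apply, sub_re, sub_im]; ring)
    refine this.congr_deriv ?_
    have hr := Real.sqrt_pos.2 hqa
    have hrr : √(gap a) ^ 2 = gap a := Real.sq_sqrt hqa.le
    have hDτ := hD τ
    field_simp
    rw [hrr]
  have hcongr : ∫ τ in (0 : ℝ)..1, ∫ s in (0 : ℝ)..1, K * s * density (triangleMap a b c (τ, s)) =
      ∫ τ in (0 : ℝ)..1, ((1 - dot a (X τ)) * K / (√(gap (X τ)) * D τ) + -(√(gap a) * K / D τ)) := by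
    refine intervalIntegral.integral_congr fun τ hτ => ?_
    rw [uIcc_of_le zero_le_one] at hτ
    rw [hinner τ hτ, sub_eq_add_neg]
  have hXc : Continuous X := by rw [hX]; fun_prop
  have hdotc : ∀ {f g : ℝ → ℂ}, Continuous f → Continuous g → Continuous fun τ => dot (f τ) (g τ) := by
    intro f g hf hg; unfold dot; fun_prop
  have hDc : Continuous D := by
    have h1 := hdotc (hXc.sub (continuous_const (y := a))) (hXc.sub (continuous_const (y := a)))
    have h2 := hdotc (continuous_const (y := a)) (hXc.sub (continuous_const (y := a)))
    exact (h1.mul continuous_const).add (h2.pow 2)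
  rw [hcongr, intervalIntegral.integral_eq_sub_of_hasDerivAt
    (fun τ hτ => (hφ τ (by rwa [uIcc_of_le zero_le_one] at hτ)).add
      (hψ τ (by rwa [uIcc_of_le zero_le_one] at hτ)))]
  · have hX0 : X 0 = b := by simp [hX]
    have hX1 : X 1 = c := by simp [hX, hd]
    simp only [Pi.add_apply, hX0, hX1]
    have hadd := hypAngle_add (x := a) (u := b - a) (v := c - a) (w := d) hqa h
      (by rw [← hX1, hcross]; exact h) (by rw [← hX0, hcross]; exact h)
    have cb : cross (c - b) (a - b) = K := by
      simp only [hK, cross_def, sub_re, sub_im]; ring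
    have cc : cross (a - c) (b - c) = K := by
      simp only [hK, cross_def, sub_re, sub_im]; ring
    have cbd : cross (b - a) d = K := by rw [← hX0, hcross]
    have ccd : cross (c - a) d = K := by rw [← hX1, hcross]
    rw [hypAngle_eq (u := c - a) (v := d) hqa (by rw [ccd]; exact h),
      hypAngle_eq (u := b - a) (v := d) hqa (by rw [cbd]; exact h), ccd, cbd] at hadd
    rw [hypAngle_eq (x := b) (gap_pos hb) (by rw [cb]; exact h), cb,
      hypAngle_eq (x := c) (gap_pos hc) (by rw [cc]; exact h), cc]
    have eb : gap b * dot (c - b) (a - b) + dot b (c - b) * dot b (a - b) =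
        gap b * dot d a - dot d b * (1 - dot b a) := by
      simp only [hd, gap, dot, sub_re, sub_im]; ring
    -- At `c` the direction `d` points out of the triangle, so the moving angle ends at the
    -- supplement of the interior angle. This is the source of the `π` in the defect.
    have ec : (gap c * dot d a - dot d c * (1 - dot c a)) / (√(gap c) * K) =
        -((gap c * dot (a - c) (b - c) + dot c (a - c) * dot c (b - c)) / (√(gap c) * K)) := by
      rw [← neg_div]; congr 1
      simp only [hd, gap, dot, sub_re, sub_im]; ring
    rw [ec, Real.arctan_neg, eb]
    linarith
  · refine ContinuousOn.intervalIntegrable ?_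
    rw [uIcc_of_le zero_le_one]
    have h1 := hdotc (continuous_const (y := a)) hXc
    have h2 := (continuous_gap.comp hXc).sqrt
    refine ContinuousOn.add (ContinuousOn.div
      ((continuous_const.sub h1).mul continuous_const).continuousOn (h2.mul hDc).continuousOn ?_)
      (ContinuousOn.neg (ContinuousOn.div (by fun_prop) hDc.continuousOn fun τ _ => (hD τ).ne'))
    intro τ hτ
    have := hD τ
    have := Real.sqrt_pos.2 (hXg τ hτ)
    positivity

/-! ### The area of a right-angled polygon -/

lemma volume_cross_eq_zero {u : ℂ} (hu : u ≠ 0) (a : ℂ) : volume {x | cross u (x - a) = 0} = 0 := by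
  let ℓ : ℂ →ₗ[ℝ] ℝ :=
    { toFun := cross u
      map_add' := fun x y => by simp only [cross_def, add_re, add_im]; ring
      map_smul' := fun c x => by
        simp only [cross_def, real_smul, re_ofReal_mul, im_ofReal_mul, smul_eq_mul,
          RingHom.id_apply]
        ring }
  have hker : volume (LinearMap.ker ℓ : Set ℂ) = 0 := by
    refine Measure.addHaar_submodule _ _ fun htop => hu ?_
    have h1 : cross u 1 = 0 := LinearMap.mem_ker.1 (htop ▸ Submodule.mem_top : (1 : ℂ) ∈ LinearMap.ker ℓ)
    have h2 : cross u I = 0 := LinearMap.mem_ker.1 (htop ▸ Submodule.mem_top : I ∈ LinearMap.ker ℓ)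
    simp [cross_def] at h1 h2
    exact Complex.ext h2 h1
  have : {x | cross u (x - a) = 0} = (fun x => x + -a) ⁻¹' (LinearMap.ker ℓ : Set ℂ) := by
    ext x
    simp only [mem_ofPred_eq, mem_preimage, SetLike.mem_coe, LinearMap.mem_ker, ← sub_eq_add_neg]
    rfl
  rw [this, measure_preimage_add_right, hker]

lemma isCompact_triangle (a b c : ℂ) : IsCompact (convexHull ℝ ({a, b, c} : Set ℂ)) :=
  (Set.toFinite _).isCompact_convexHull ℝ

/-- The line through `P 0` and `P k` separates the new triangle from all earlier ones, so they
overlap only in a null set. -/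
lemma integral_density_fan {m : ℕ} {P : ℕ → ℂ} (hnorm : ∀ i ≤ m, ‖P i‖ < 1)
    (hP : ∀ i j k, i < j → j < k → k ≤ m → 0 < cross (P j - P i) (P k - P i))
    {k : ℕ} (hk : k ≤ m) :
    ∫ x in ⋃ i ∈ Finset.Ico 1 k, convexHull ℝ {P 0, P i, P (i + 1)}, density x =
      ∑ i ∈ Finset.Ico 1 k, ∫ x in convexHull ℝ {P 0, P i, P (i + 1)}, density x := by
  have hintegral : ∀ i < m, IntegrableOn density (convexHull ℝ {P 0, P i, P (i + 1)}) := by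
    intro i hi
    refine (continuousOn_density.mono fun x hx => ?_).integrableOn_compact (isCompact_triangle _ _ _)
    refine norm_lt_one_of_mem_convexHull (s := {P 0, P i, P (i + 1)}) ?_ hx
    rintro x (rfl | rfl | rfl) <;> exact hnorm _ (by omega)
  induction k with
  | zero => simp
  | succ k ih =>
    rcases Nat.lt_or_ge k 1 with h0 | h0
    · obtain rfl : k = 0 := by omega
      simp
    rw [Finset.sum_Ico_succ_top h0, ← ih (by omega), ← Finset.insert_Ico_right_eq_Ico_add_one h0,
      Finset.set_biUnion_insert, union_comm]
    have hPk : P k - P 0 ≠ 0 := by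
      intro h'
      have := hP 0 k (k + 1) (by omega) (by omega) hk
      rw [h'] at this
      simp [cross_def] at this
    have hnn : ∀ j ≤ k, cross (P k - P 0) (P j - P 0) ≤ 0 := by
      intro j hj
      rcases Nat.eq_zero_or_pos j with rfl | hj0
      · simp [cross_def]
      rcases hj.eq_or_lt with rfl | hj'
      · simp [cross_def, mul_comm]
      · have := hP 0 j k hj0 hj' (by omega)
        rw [cross_swap] at this; linarith
    refine setIntegral_union₀ ?_ (isCompact_triangle _ _ _).measurableSet.nullMeasurableSet ?_
      (hintegral k (by omega))
    · refine measure_mono_null ?_ (volume_cross_eq_zero hPk (P 0))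
      rintro x ⟨hx1, hx2⟩
      refine le_antisymm ?_ ?_
      · simp only [mem_iUnion, Finset.mem_Ico] at hx1
        obtain ⟨i, ⟨hi1, hik⟩, hx1⟩ := hx1
        refine convexHull_min ?_ (convex_cross_nonpos (P k - P 0) (P 0)) hx1
        rintro y (rfl | rfl | rfl) <;> exact hnn _ (by omega)
      · refine convexHull_min ?_ (convex_cross_nonneg (P k - P 0) (P 0)) hx2
        rintro y (rfl | rfl | rfl)
        · simp [cross_def]
        · simp [cross_def, mul_comm]
        · exact (hP 0 k (k + 1) (by omega) (by omega) hk).le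
    · refine (integrableOn_finset_iUnion).2 fun i hi => hintegral i ?_
      rw [Finset.mem_Ico] at hi; omega

/-- The angular defect of a fan of triangles whose union has right angles. -/
lemma sum_defect_fan {m : ℕ} {P : ℕ → ℂ} (hnorm : ∀ i ≤ m, ‖P i‖ < 1)
    (hP : ∀ i j k, i < j → j < k → k ≤ m → 0 < cross (P j - P i) (P k - P i))
    (hr : ∀ i, i + 2 ≤ m →
      hypAngle (P (i + 1)) (P (i + 2) - P (i + 1)) (P i - P (i + 1)) = Real.pi / 2)
    {k : ℕ} (hk2 : 2 ≤ k) (hk : k ≤ m) :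
    ∑ i ∈ Finset.Ico 1 k, (Real.pi - hypAngle (P 0) (P i - P 0) (P (i + 1) - P 0)
      - hypAngle (P i) (P (i + 1) - P i) (P 0 - P i)
      - hypAngle (P (i + 1)) (P 0 - P (i + 1)) (P i - P (i + 1))) =
    (k - 1) * (Real.pi / 2) - hypAngle (P 0) (P 1 - P 0) (P k - P 0)
      - hypAngle (P k) (P 0 - P k) (P (k - 1) - P k) := by
  induction k, hk2 using Nat.le_induction with
  | base =>
    have := hr 0 (by omega)
    simp only [zero_add] at this
    simp [this]
    ring
  | succ k hk2 ih =>
    rw [Finset.sum_Ico_succ_top (by omega), ih (by omega)]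
    obtain ⟨l, rfl⟩ : ∃ l, k = l + 1 := ⟨k - 1, by omega⟩
    -- Angles at the apex `P 0` accumulate. At the vertex shared with the new triangle, the angle of
    -- the old fan and that of the new triangle make up one right angle.
    have h1 := hypAngle_add (x := P 0) (gap_pos (hnorm 0 (by omega)))
      (hP 0 1 (l + 1) (by omega) (by omega) (by omega))
      (hP 0 (l + 1) (l + 1 + 1) (by omega) (by omega) hk) (hP 0 1 (l + 1 + 1) (by omega) (by omega) hk)
    have c1 := hP 0 (l + 1) (l + 1 + 1) (by omega) (by omega) hk
    have c2 := hP 0 l (l + 1) (by omega) (by omega) (by omega)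
    have c3 := hP l (l + 1) (l + 1 + 1) (by omega) (by omega) hk
    have h2 := hypAngle_add (x := P (l + 1)) (u := P (l + 1 + 1) - P (l + 1)) (v := P 0 - P (l + 1))
      (w := P l - P (l + 1)) (gap_pos (hnorm (l + 1) (by omega)))
      (by simp only [cross_def, sub_re, sub_im] at c1 ⊢; linarith)
      (by simp only [cross_def, sub_re, sub_im] at c2 ⊢; linarith)
      (by simp only [cross_def, sub_re, sub_im] at c3 ⊢; linarith)
    have h3 := hr l (by omega)
    simp only [Nat.add_sub_cancel]
    push_cast
    linarith

lemma norm_lt_one_of_mem_region {e : ℕ} {L : ℝ} {p : Fin e → ℂ} (hp : IsRightAngledPolygon L p)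
    {x : ℂ} (hx : x ∈ region p) : ‖x‖ < 1 := by
  refine norm_lt_one_of_mem_convexHull (s := range p) ?_ hx
  rintro _ ⟨i, rfl⟩
  exact hp.mem_disk i

lemma isCompact_region {e : ℕ} (p : Fin e → ℂ) : IsCompact (region p) :=
  (Set.finite_range p).isCompact_convexHull ℝ

lemma area_eq {e : ℕ} {L : ℝ} {p : Fin e → ℂ} (hp : IsRightAngledPolygon L p) :
    area L (region p) = L ^ 2 * ∫ x in region p, density x := by
  rw [area, ← integral_const_mul]
  exact setIntegral_congr_fun (isCompact_region p).measurableSet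
    fun x hx => sqrt_det_metric L (norm_lt_one_of_mem_region hp hx)

lemma IsRightAngledPolygon.hypAngle_eq {e : ℕ} {L : ℝ} (hL : 0 < L) {p : Fin e → ℂ}
    (hp : IsRightAngledPolygon L p) {i j k : Fin e} (hij : finRotate e i = j)
    (hjk : finRotate e j = k) (hpos : 0 < cross (p k - p j) (p i - p j)) :
    hypAngle (p j) (p k - p j) (p i - p j) = Real.pi / 2 := by
  have h := hp.right_angle j
  rw [hjk, (finRotate e).symm_apply_eq.2 hij.symm, metric_eq] at h
  have hg := gap_pos (hp.mem_disk j)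
  have h0 : gap (p j) * dot (p k - p j) (p i - p j) +
      dot (p j) (p k - p j) * dot (p j) (p i - p j) = 0 := by
    have h' := (mul_eq_zero.1 h).resolve_left (by positivity)
    field_simp at h'
    linarith
  rw [KinematicSpace.hypAngle_eq hg hpos, h0]
  simp

/-- The area of a right-angled polygon with `m + 1` vertices. -/
theorem area_rightAngledPolygon {m : ℕ} (hm : 2 ≤ m) {L : ℝ} (hL : 0 < L) {p : Fin (m + 1) → ℂ}
    (hp : IsRightAngledPolygon L p) :
    area L (region p) = L ^ 2 * ((m - 3) * (Real.pi / 2)) := by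
  set P := vertexSeq m.succ_pos p with hPdef
  have hP : ∀ i j k, i < j → j < k → k ≤ m → 0 < cross (P j - P i) (P k - P i) :=
    fun i j k hij hjk hk => hp.isConvexPolygon.cross_vertexSeq_pos hij hjk hk
  have hnorm : ∀ i, ‖P i‖ < 1 := fun i => hp.mem_disk _
  have hval : ∀ i (hi : i < m + 1), P i = p ⟨i, hi⟩ := fun i hi => by
    simp only [hPdef, vertexSeq, Nat.mod_eq_of_lt hi]
  have hang : ∀ i j k (hi : i < m + 1) (hj : j < m + 1) (hk : k < m + 1), j = (i + 1) % (m + 1) →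
      k = (j + 1) % (m + 1) → 0 < cross (P k - P j) (P i - P j) →
      hypAngle (P j) (P k - P j) (P i - P j) = Real.pi / 2 := by
    intro i j k hi hj hk hij hjk hpos
    rw [hval i hi, hval j hj, hval k hk] at *
    exact hp.hypAngle_eq hL (Fin.ext (by rw [finRotate_val]; exact hij.symm))
      (Fin.ext (by rw [finRotate_val]; exact hjk.symm)) hpos
  rw [area_eq hp, (hp.isConvexPolygon.region_eq hm).1,
    integral_density_fan (fun i _ => hnorm i) hP le_rfl]
  congr 1
  have hcongr : ∀ i ∈ Finset.Ico 1 m, ∫ x in convexHull ℝ {P 0, P i, P (i + 1)}, density x =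
      Real.pi - hypAngle (P 0) (P i - P 0) (P (i + 1) - P 0)
      - hypAngle (P i) (P (i + 1) - P i) (P 0 - P i)
      - hypAngle (P (i + 1)) (P 0 - P (i + 1)) (P i - P (i + 1)) := by
    intro i hi
    rw [Finset.mem_Ico] at hi
    exact integral_density_triangle (hnorm _) (hnorm _) (hnorm _)
      (hP 0 i (i + 1) (by omega) (by omega) (by omega))
  rw [Finset.sum_congr rfl hcongr, sum_defect_fan (fun i _ => hnorm i) hP ?_ hm le_rfl]
  -- The two angles left by the fan sum are those at the first and last vertices, where the cyclic
  -- indexing wraps around.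
  · have h0 := hang m 0 1 (by omega) (by omega) (by omega) (by simp)
      (by rw [Nat.mod_eq_of_lt (by omega)]) (hP 0 1 m (by omega) (by omega) le_rfl)
    have h1 := hang (m - 1) m 0 (by omega) (by omega) (by omega)
      (by rw [Nat.sub_add_cancel (by omega), Nat.mod_eq_of_lt (by omega)]) (by simp) (by
        have := hP 0 (m - 1) m (by omega) (by omega) le_rfl
        simp only [cross_def, sub_re, sub_im] at this ⊢; linarith)
    rw [h0, h1]; ring
  · intro i hi
    refine hang i (i + 1) (i + 2) (by omega) (by omega) (by omega)
      (by rw [Nat.mod_eq_of_lt (by omega)]) (by rw [Nat.mod_eq_of_lt (by omega)]) ?_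
    have := hP i (i + 1) (i + 2) (by omega) (by omega) hi
    simp only [cross_def, sub_re, sub_im] at this ⊢; linarith

/-! ### Geodesics in coordinates -/

/-- In the frame rotated by `θ` the chord is vertical, at abscissa `cos α`. As `dot` and `gap` are
invariant under rotation, metric computations can be done in this frame. -/
lemma geodesic_eq (γ : ℝ × ℝ) (t : ℝ) :
    geodesic γ t = exp (γ.1 * I) * ⟨Real.cos γ.2, (2 * t - 1) * Real.sin γ.2⟩ := by
  have h1 : boundaryPoint (γ.1 - γ.2) = exp (γ.1 * I) * ⟨Real.cos γ.2, -Real.sin γ.2⟩ := by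
    have h : exp (((-γ.2 : ℝ) : ℂ) * I) = ⟨Real.cos γ.2, -Real.sin γ.2⟩ := by
      apply Complex.ext
      · rw [exp_ofReal_mul_I_re, Real.cos_neg]
      · rw [exp_ofReal_mul_I_im, Real.sin_neg]
    rw [boundaryPoint, ← h, ← exp_add]
    congr 1
    push_cast
    ring
  have h2 : boundaryPoint (γ.1 + γ.2) = exp (γ.1 * I) * ⟨Real.cos γ.2, Real.sin γ.2⟩ := by
    have h : exp ((γ.2 : ℂ) * I) = ⟨Real.cos γ.2, Real.sin γ.2⟩ := by
      apply Complex.ext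
      · rw [exp_ofReal_mul_I_re]
      · rw [exp_ofReal_mul_I_im]
    rw [boundaryPoint, ← h, ← exp_add]
    congr 1
    push_cast
    ring
  rw [geodesic, AffineMap.lineMap_apply_module, h1, h2, ← mul_smul_comm, ← mul_smul_comm,
    ← mul_add]
  congr 1
  apply Complex.ext
  · simp only [add_re, real_smul, re_ofReal_mul]; ring
  · simp only [add_im, real_smul, im_ofReal_mul]; ring

lemma hasDerivAt_geodesic (γ : ℝ × ℝ) (t : ℝ) :
    HasDerivAt (geodesic γ) (exp (γ.1 * I) * ⟨0, 2 * Real.sin γ.2⟩) t := by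
  have h : HasDerivAt (geodesic γ) (boundaryPoint (γ.1 + γ.2) - boundaryPoint (γ.1 - γ.2)) t :=
    AffineMap.hasDerivAt_lineMap
  have h0 : geodesic γ 0 = boundaryPoint (γ.1 - γ.2) := by simp [geodesic]
  have h1 : geodesic γ 1 = boundaryPoint (γ.1 + γ.2) := by simp [geodesic]
  rw [← h0, ← h1, geodesic_eq, geodesic_eq, ← mul_sub] at h
  refine h.congr_deriv ?_
  congr 1
  apply Complex.ext
  · simp
  · simp; ring

lemma dot_exp_mul (θ : ℝ) (a b : ℂ) : dot (exp (θ * I) * a) (exp (θ * I) * b) = dot a b := by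
  simp only [dot, mul_re, mul_im, exp_ofReal_mul_I_re, exp_ofReal_mul_I_im]
  linear_combination (a.re * b.re + a.im * b.im) * Real.cos_sq_add_sin_sq θ

lemma gap_eq_dot (x : ℂ) : gap x = 1 - dot x x := rfl

lemma gap_exp_mul (θ : ℝ) (a : ℂ) : gap (exp (θ * I) * a) = gap a := by
  rw [gap_eq_dot, dot_exp_mul, ← gap_eq_dot]

lemma gap_geodesic (γ : ℝ × ℝ) (t : ℝ) :
    gap (geodesic γ t) = 4 * Real.sin γ.2 ^ 2 * (t * (1 - t)) := by
  rw [geodesic_eq, gap_exp_mul]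
  simp only [gap]
  linear_combination -Real.sin_sq_add_cos_sq γ.2

lemma continuous_geodesic : Continuous fun z : (ℝ × ℝ) × ℝ => geodesic z.1 z.2 := by
  simp only [geodesic, boundaryPoint, AffineMap.lineMap_apply_module]
  fun_prop

lemma continuous_geodesic_right (γ : ℝ × ℝ) : Continuous (geodesic γ) :=
  continuous_iff_continuousAt.2 fun t => (hasDerivAt_geodesic γ t).continuousAt

/-- The factors `sin α` cancel, so the speed depends on the parameter `t` but not on the geodesic.
-/
lemma sqrt_metric_geodesic {L : ℝ} (hL : 0 < L) {γ : ℝ × ℝ} (hγ : γ ∈ kinematicSpace) {t : ℝ}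
    (ht : t ∈ Ioo (0 : ℝ) 1) :
    √(metric L (geodesic γ t) (deriv (geodesic γ) t) (deriv (geodesic γ) t)) =
      L / (2 * (t * (1 - t))) := by
  have hs : 0 < Real.sin γ.2 := Real.sin_pos_of_pos_of_lt_pi hγ.2.1 hγ.2.2
  have ht1 : 0 < 1 - t := by linarith [ht.2]
  have ht0 : 0 < t := ht.1
  rw [(hasDerivAt_geodesic γ t).deriv, metric_eq, gap_geodesic, geodesic_eq, dot_exp_mul,
    dot_exp_mul]
  have : L ^ 2 * (dot ⟨0, 2 * Real.sin γ.2⟩ ⟨0, 2 * Real.sin γ.2⟩ /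
      (4 * Real.sin γ.2 ^ 2 * (t * (1 - t))) +
      dot ⟨Real.cos γ.2, (2 * t - 1) * Real.sin γ.2⟩ ⟨0, 2 * Real.sin γ.2⟩ *
      dot ⟨Real.cos γ.2, (2 * t - 1) * Real.sin γ.2⟩ ⟨0, 2 * Real.sin γ.2⟩ /
      (4 * Real.sin γ.2 ^ 2 * (t * (1 - t))) ^ 2) = (L / (2 * (t * (1 - t)))) ^ 2 := by
    simp only [dot]
    field_simp
    ring
  rw [this, Real.sqrt_sq (by positivity)]

/-- The cutoff only adds a constant to the entropy on `(0, π)`, and the second derivative of `log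
(sin α)` is `-1 / sin α ^ 2`. -/
lemma croftonDensity_eq (L G : ℝ) {ε : ℝ} (hε : 0 < ε) {γ : ℝ × ℝ} (hγ : γ ∈ kinematicSpace) :
    croftonDensity L G ε γ = L / (4 * G) / Real.sin γ.2 ^ 2 := by
  have hd : ∀ α ∈ Ioo 0 Real.pi,
      HasDerivAt (entropy L G ε) (L / (2 * G) * (Real.cos α / Real.sin α)) α := by
    intro α hα
    have hs : 0 < Real.sin α := Real.sin_pos_of_pos_of_lt_pi hα.1 hα.2
    have := ((((Real.hasDerivAt_sin α).const_mul 2).div_const ε).log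
      (by positivity)).const_mul (L / (2 * G))
    refine this.congr_deriv ?_
    field_simp
  have hs : 0 < Real.sin γ.2 := Real.sin_pos_of_pos_of_lt_pi hγ.2.1 hγ.2.2
  have hev : deriv (entropy L G ε) =ᶠ[nhds γ.2]
      fun α => L / (2 * G) * (Real.cos α / Real.sin α) := by
    filter_upwards [Ioo_mem_nhds hγ.2.1 hγ.2.2] with α hα using (hd α hα).deriv
  have h2 : HasDerivAt (fun α => L / (2 * G) * (Real.cos α / Real.sin α))
      (L / (2 * G) * (-1 / Real.sin γ.2 ^ 2)) γ.2 := by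
    refine (((Real.hasDerivAt_cos γ.2).div (Real.hasDerivAt_sin γ.2) hs.ne').const_mul
      _).congr_deriv ?_
    rw [show -Real.sin γ.2 * Real.sin γ.2 - Real.cos γ.2 * Real.cos γ.2 = -1 by
      linear_combination -Real.sin_sq_add_cos_sq γ.2]
  rw [croftonDensity, iteratedDeriv_succ, iteratedDeriv_one, hev.deriv_eq, h2.deriv]
  ring

/-! ### Chord lengths of a compact subset of the disk -/

section compact

variable {Q : Set ℂ}

/-- The gap vanishes at `t = 0` and `t = 1`, so closing the parameter interval adds nothing; this is
what makes `times` compact. -/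
lemma times_eq (hQ : ∀ x ∈ Q, ‖x‖ < 1) (γ : ℝ × ℝ) :
    times Q γ = Icc 0 1 ∩ geodesic γ ⁻¹' Q := by
  ext t
  simp only [times, mem_ofPred_eq, mem_inter_iff, mem_preimage]
  refine ⟨fun h => ⟨Ioo_subset_Icc_self h.1, h.2⟩, fun h => ⟨?_, h.2⟩⟩
  have h1 := gap_pos (hQ _ h.2)
  rw [gap_geodesic] at h1
  have h2 : 0 < t * (1 - t) := pos_of_mul_pos_right h1 (by positivity)
  rcases h.1.1.eq_or_lt with h0 | h0
  · rw [← h0] at h2; simp at h2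
  · exact ⟨h0, by by_contra h3; nlinarith⟩

lemma isCompact_times (hQc : IsCompact Q) (hQ : ∀ x ∈ Q, ‖x‖ < 1) (γ : ℝ × ℝ) :
    IsCompact (times Q γ) := by
  rw [times_eq hQ]
  refine isCompact_Icc.inter_right (hQc.isClosed.preimage (continuous_geodesic_right γ))

/-- The integrand of the total integral of chords, with the point of the chord as a variable. -/
def chordKernel (L G : ℝ) (Q : Set ℂ) (γ : ℝ × ℝ) (t : ℝ) : ENNReal :=
  -- The constant is `L / 2` from the length element times `L / (4 * G)` from the Crofton density.
  ENNReal.ofReal (L ^ 2 / (8 * G) / (Real.sin γ.2 ^ 2 * (t * (1 - t)))) *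
    Q.indicator 1 (geodesic γ t)

lemma measurable_chordKernel (L G : ℝ) (hQc : IsCompact Q) :
    Measurable fun z : (ℝ × ℝ) × ℝ => chordKernel L G Q z.1 z.2 := by
  unfold chordKernel
  refine Measurable.mul (by fun_prop) ?_
  have h : Measurable (Q.indicator (1 : ℂ → ENNReal)) :=
    measurable_one.indicator hQc.measurableSet
  exact h.comp continuous_geodesic.measurable

lemma chord_eq {L : ℝ} (hL : 0 < L) (hQc : IsCompact Q) (hQ : ∀ x ∈ Q, ‖x‖ < 1) {γ : ℝ × ℝ}
    (hγ : γ ∈ kinematicSpace) : chord L Q γ = ∫ t in times Q γ, L / (2 * (t * (1 - t))) :=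
  setIntegral_congr_fun (isCompact_times hQc hQ γ).measurableSet
    fun _ ht => sqrt_metric_geodesic hL hγ ht.1

lemma chord_nonneg (L : ℝ) (γ : ℝ × ℝ) : 0 ≤ chord L Q γ :=
  integral_nonneg fun _ => Real.sqrt_nonneg _

/-- Values in `ENNReal` allow Tonelli before integrability is known; integrability later follows
from the finite total. -/
lemma ofReal_chord_mul {L G ε : ℝ} (hL : 0 < L) (hG : 0 < G) (hε : 0 < ε) (hQc : IsCompact Q)
    (hQ : ∀ x ∈ Q, ‖x‖ < 1) {γ : ℝ × ℝ} (hγ : γ ∈ kinematicSpace) :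
    ENNReal.ofReal (chord L Q γ * croftonDensity L G ε γ) =
      ∫⁻ t in Ioo (0 : ℝ) 1, chordKernel L G Q γ t := by
  have hs : 0 < Real.sin γ.2 := Real.sin_pos_of_pos_of_lt_pi hγ.2.1 hγ.2.2
  have hcont : ContinuousOn (fun t : ℝ => L / (2 * (t * (1 - t))) * (L / (4 * G) / Real.sin γ.2 ^ 2))
      (times Q γ) := by
    refine (ContinuousOn.div (by fun_prop) (by fun_prop) fun t ht => ?_).mul (by fun_prop)
    have h1 : 0 < t := ht.1.1
    have h2 : 0 < 1 - t := by linarith [ht.1.2]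
    positivity
  have hm := (isCompact_times hQc hQ γ).measurableSet
  rw [croftonDensity_eq L G hε hγ, chord_eq hL hQc hQ hγ, ← integral_mul_const,
    ofReal_integral_eq_lintegral_ofReal (hcont.integrableOn_compact (isCompact_times hQc hQ γ))]
  · have hker : ∀ t, chordKernel L G Q γ t = (geodesic γ ⁻¹' Q).indicator
        (fun t => ENNReal.ofReal (L ^ 2 / (8 * G) / (Real.sin γ.2 ^ 2 * (t * (1 - t))))) t := by
      intro t
      by_cases h : geodesic γ t ∈ Q
      · rw [chordKernel, indicator_of_mem h, indicator_of_mem (by exact h)]; simp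
      · rw [chordKernel, indicator_of_notMem h, indicator_of_notMem (by exact h)]; simp
    have hpre : MeasurableSet (geodesic γ ⁻¹' Q) :=
      (continuous_geodesic_right γ).measurable hQc.measurableSet
    simp only [hker]
    rw [setLIntegral_indicator hpre]
    have : geodesic γ ⁻¹' Q ∩ Ioo 0 1 = times Q γ := by
      ext t; simp [times, and_comm]
    rw [this]
    refine setLIntegral_congr_fun hm fun t ht => ?_
    have h1 : 0 < t := ht.1.1
    have h2 : 0 < 1 - t := by linarith [ht.1.2]
    congr 1
    field_simp
    ring
  · refine (ae_restrict_iff' hm).2 (ae_of_all _ fun t ht => ?_)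
    have h1 : 0 < t := ht.1.1
    have h2 : 0 < 1 - t := by linarith [ht.1.2]
    simp only [Pi.zero_apply]
    positivity

end compact

/-! ### Integration over the chords of a fixed direction -/

/-- The coordinates of a point of the disk relative to the chords of a fixed direction. -/
def chordMap (z : ℝ × ℝ) : ℝ × ℝ := (Real.cos z.1, (2 * z.2 - 1) * Real.sin z.1)

lemma chordMap_injOn : InjOn chordMap (Ioo 0 Real.pi ×ˢ Ioo 0 1) := by
  rintro ⟨α, t⟩ ⟨hα, -⟩ ⟨α', t'⟩ ⟨hα', -⟩ h
  simp only [chordMap, Prod.mk.injEq] at h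
  obtain rfl : α = α' :=
    Real.injOn_cos (Ioo_subset_Icc_self hα) (Ioo_subset_Icc_self hα') h.1
  have hs : 0 < Real.sin α := Real.sin_pos_of_pos_of_lt_pi hα.1 hα.2
  have := mul_right_cancel₀ hs.ne' h.2
  rw [show t = t' by linarith]

lemma chordMap_image :
    chordMap '' (Ioo 0 Real.pi ×ˢ Ioo 0 1) = {y | y.1 ^ 2 + y.2 ^ 2 < 1} := by
  ext ⟨a, b⟩
  constructor
  · rintro ⟨⟨α, t⟩, ⟨hα, ht⟩, h⟩
    simp only [chordMap, Prod.mk.injEq] at h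
    obtain ⟨rfl, rfl⟩ := h
    have hs : 0 < Real.sin α := Real.sin_pos_of_pos_of_lt_pi hα.1 hα.2
    have h1 : 0 < t * (1 - t) := mul_pos ht.1 (by linarith [ht.2])
    have h2 : 0 < 4 * Real.sin α ^ 2 * (t * (1 - t)) := by positivity
    simp only [mem_ofPred_eq]
    nlinarith [Real.sin_sq_add_cos_sq α]
  · intro h
    simp only [mem_ofPred_eq] at h
    have ha1 : -1 < a := by nlinarith [sq_nonneg b]
    have ha2 : a < 1 := by nlinarith [sq_nonneg b]
    have hs : Real.sin (Real.arccos a) = √(1 - a ^ 2) := Real.sin_arccos a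
    have hpos : 0 < 1 - a ^ 2 := by nlinarith [sq_nonneg b]
    have hr := Real.sqrt_pos.2 hpos
    have hb : |b| < √(1 - a ^ 2) := Real.lt_sqrt_of_sq_lt (by rw [sq_abs]; linarith)
    rw [abs_lt] at hb
    refine ⟨(Real.arccos a, (b / √(1 - a ^ 2) + 1) / 2), ⟨⟨Real.arccos_pos.2 ha2, ?_⟩, ?_, ?_⟩, ?_⟩
    · exact lt_of_le_of_ne (Real.arccos_le_pi a) fun h => by
        rw [Real.arccos_eq_pi] at h; linarith
    · have : -1 < b / √(1 - a ^ 2) := by rw [lt_div_iff₀ hr]; linarith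
      simp only; linarith
    · have : b / √(1 - a ^ 2) < 1 := by rw [div_lt_one hr]; linarith
      simp only; linarith
    · simp only [chordMap, hs, Real.cos_arccos ha1.le ha2.le, Prod.mk.injEq, true_and]
      field_simp
      ring

lemma lintegral_chordMap (g : ℝ × ℝ → ENNReal) :
    ∫⁻ y in {y : ℝ × ℝ | y.1 ^ 2 + y.2 ^ 2 < 1}, g y =
      ∫⁻ z in Ioo 0 Real.pi ×ˢ Ioo 0 1, ENNReal.ofReal (2 * Real.sin z.1 ^ 2) * g (chordMap z) := by
  set M : ℝ × ℝ → (ℝ × ℝ →L[ℝ] ℝ × ℝ) := fun z => LinearMap.toContinuousLinearMap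
    (Matrix.toLin (Module.Basis.finTwoProd ℝ) (Module.Basis.finTwoProd ℝ)
      !![-Real.sin z.1, 0; (2 * z.2 - 1) * Real.cos z.1, 2 * Real.sin z.1]) with hM
  have hder : ∀ z ∈ Ioo 0 Real.pi ×ˢ Ioo (0 : ℝ) 1,
      HasFDerivWithinAt chordMap (M z) (Ioo 0 Real.pi ×ˢ Ioo 0 1) z := by
    intro z _
    refine HasFDerivAt.hasFDerivWithinAt ?_
    rw [hM]
    simp only [Matrix.toLin_finTwoProd_toContinuousLinearMap]
    have h1 : HasFDerivAt (fun z : ℝ × ℝ => z.1) (ContinuousLinearMap.fst ℝ ℝ ℝ) z :=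
      hasFDerivAt_fst
    have h2 : HasFDerivAt (fun z : ℝ × ℝ => z.2) (ContinuousLinearMap.snd ℝ ℝ ℝ) z :=
      hasFDerivAt_snd
    refine HasFDerivAt.prodMk ?_ ?_
    · refine h1.cos.congr_fderiv ?_
      ext <;> simp
    · refine (((h2.const_mul 2).sub_const 1).mul h1.sin).congr_fderiv ?_
      ext <;> simp [mul_comm]
  rw [← chordMap_image, lintegral_image_eq_lintegral_abs_det_fderiv_mul volume
    (measurableSet_Ioo.prod measurableSet_Ioo) hder chordMap_injOn]
  refine lintegral_congr fun z => ?_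
  have hdet : (M z).det = -(2 * Real.sin z.1 ^ 2) := by
    rw [hM]
    simp only [LinearMap.det_toContinuousLinearMap, LinearMap.det_toLin, Matrix.det_fin_two_of]
    ring
  rw [hdet, abs_neg, abs_of_nonneg (by positivity)]

/-! ### The Crofton formula for areas -/

section crofton

variable {Q : Set ℂ}

/-- The chords with fixed `θ` are perpendicular to `exp (θ * I)` and foliate the disk. In the
coordinates `(α, t)` area has density `2 * sin α ^ 2`, while `cos α` is the component of `x` along
`exp (θ * I)`. -/
lemma lintegral_chordKernel (L G : ℝ) (hG : 0 < G) (hQc : IsCompact Q) (hQ : ∀ x ∈ Q, ‖x‖ < 1)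
    (θ : ℝ) :
    ∫⁻ α in Ioo 0 Real.pi, ∫⁻ t in Ioo (0 : ℝ) 1, chordKernel L G Q (θ, α) t =
      ∫⁻ x in Q, ENNReal.ofReal
        (L ^ 2 / (4 * G) / (gap x * (1 - (x.re * Real.cos θ + x.im * Real.sin θ) ^ 2))) := by
  set g : ℝ × ℝ → ENNReal := fun y =>
    ENNReal.ofReal (L ^ 2 / (4 * G) / ((1 - (y.1 * y.1 + y.2 * y.2)) * (1 - y.1 ^ 2))) *
      Q.indicator 1 (exp (θ * I) * ⟨y.1, y.2⟩) with hg
  set h : ℂ → ENNReal := fun x =>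
    ENNReal.ofReal
        (L ^ 2 / (4 * G) / (gap x * (1 - (x.re * Real.cos θ + x.im * Real.sin θ) ^ 2))) *
      Q.indicator 1 x with hh
  have hmeas : Measurable fun z : ℝ × ℝ => chordKernel L G Q (θ, z.1) z.2 :=
    (measurable_chordKernel L G hQc).comp
      (g := fun z : (ℝ × ℝ) × ℝ => chordKernel L G Q z.1 z.2)
      (f := fun z : ℝ × ℝ => (((θ, z.1) : ℝ × ℝ), z.2)) (by fun_prop)
  have h1 : ∫⁻ α in Ioo 0 Real.pi, ∫⁻ t in Ioo (0 : ℝ) 1, chordKernel L G Q (θ, α) t =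
      ∫⁻ z in Ioo 0 Real.pi ×ˢ Ioo (0 : ℝ) 1, chordKernel L G Q (θ, z.1) z.2 := by
    rw [Measure.volume_eq_prod, ← Measure.prod_restrict, lintegral_prod _ hmeas.aemeasurable]
  have h2 : ∫⁻ z in Ioo 0 Real.pi ×ˢ Ioo (0 : ℝ) 1, chordKernel L G Q (θ, z.1) z.2 =
      ∫⁻ z in Ioo 0 Real.pi ×ˢ Ioo 0 1,
        ENNReal.ofReal (2 * Real.sin z.1 ^ 2) * g (chordMap z) := by
    refine setLIntegral_congr_fun (measurableSet_Ioo.prod measurableSet_Ioo) fun z hz => ?_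
    have hs : 0 < Real.sin z.1 := Real.sin_pos_of_pos_of_lt_pi hz.1.1 hz.1.2
    have ht0 : 0 < z.2 := hz.2.1
    have ht1 : 0 < 1 - z.2 := by linarith [hz.2.2]
    simp only [chordKernel, hg, chordMap, geodesic_eq]
    rw [← mul_assoc (ENNReal.ofReal (2 * Real.sin z.1 ^ 2)), ← ENNReal.ofReal_mul (by positivity)]
    congr 2
    have e1 : 1 - (Real.cos z.1 * Real.cos z.1 +
        (2 * z.2 - 1) * Real.sin z.1 * ((2 * z.2 - 1) * Real.sin z.1)) =
        4 * Real.sin z.1 ^ 2 * (z.2 * (1 - z.2)) := by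
      linear_combination -Real.sin_sq_add_cos_sq z.1
    have e2 : 1 - Real.cos z.1 ^ 2 = Real.sin z.1 ^ 2 := by
      linear_combination -Real.sin_sq_add_cos_sq z.1
    rw [e1, e2]
    field_simp
    ring
  -- Since `Q` lies in the disk, the integrand vanishes outside it, and the rotation can be applied
  -- on the whole plane.
  have h3 : ∫⁻ y in {y : ℝ × ℝ | y.1 ^ 2 + y.2 ^ 2 < 1}, g y = ∫⁻ y, g y := by
    rw [← lintegral_indicator (measurableSet_lt (by fun_prop) (by fun_prop))]
    refine lintegral_congr fun y => ?_
    by_cases hy : y.1 ^ 2 + y.2 ^ 2 < 1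
    · rw [indicator_of_mem (by exact hy)]
    · rw [indicator_of_notMem (by exact hy), hg]
      simp only
      rw [indicator_of_notMem, mul_zero]
      intro hyQ
      have := gap_pos (hQ _ hyQ)
      rw [gap_exp_mul] at this
      simp only [gap] at this
      exact hy (by nlinarith)
  have h4 : ∫⁻ y, g y = ∫⁻ w : ℂ, g (w.re, w.im) :=
    (Complex.volume_preserving_equiv_real_prod.lintegral_comp_emb
      Complex.measurableEquivRealProd.measurableEmbedding g).symm
  have hrot : ∀ w : ℂ, g (w.re, w.im) = h (rotation (Circle.exp θ) w) := by
    intro w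
    have e : rotation (Circle.exp θ) w = exp (θ * I) * w := by
      rw [rotation_apply, Circle.coe_exp]
    rw [e, hg, hh]
    simp only [gap_exp_mul]
    congr 3
    simp only [gap, mul_re, mul_im, exp_ofReal_mul_I_re, exp_ofReal_mul_I_im]
    congr 3
    linear_combination -w.re * Real.cos_sq_add_sin_sq θ
  have h5 : ∫⁻ w : ℂ, g (w.re, w.im) = ∫⁻ x, h x := by
    simp only [hrot]
    exact (rotation (Circle.exp θ)).measurePreserving.lintegral_comp_emb
      (rotation (Circle.exp θ)).toHomeomorph.measurableEmbedding h
  rw [h1, h2, ← lintegral_chordMap, h3, h4, h5, ← lintegral_indicator hQc.measurableSet]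
  refine lintegral_congr fun x => ?_
  by_cases hx : x ∈ Q
  · rw [hh]; simp [hx]
  · rw [hh]; simp [hx]

/-- The usual antiderivative `arctan (tan φ / c) / c` jumps where `cos φ = 0`. The addition formula
for the tangent rewrites it as `φ` plus a periodic correction that is smooth on the whole line. -/
lemma hasDerivAt_angular {c : ℝ} (hc : 0 < c) (φ : ℝ) :
    HasDerivAt (fun φ => (φ + Real.arctan ((1 - c) * (Real.sin φ * Real.cos φ) /
      (c * Real.cos φ ^ 2 + Real.sin φ ^ 2))) / c)
      (1 / (Real.sin φ ^ 2 + c ^ 2 * Real.cos φ ^ 2)) φ := by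
  have hsc := Real.sin_sq_add_cos_sq φ
  have hden : 0 < c * Real.cos φ ^ 2 + Real.sin φ ^ 2 := by
    rcases (sq_nonneg (Real.sin φ)).eq_or_lt with h | h
    · rw [← h] at hsc ⊢; nlinarith
    · positivity
  have hden' : 0 < Real.sin φ ^ 2 + c ^ 2 * Real.cos φ ^ 2 := by
    rcases (sq_nonneg (Real.sin φ)).eq_or_lt with h | h
    · rw [← h] at hsc ⊢; nlinarith
    · positivity
  have hs := Real.hasDerivAt_sin φ
  have hco := Real.hasDerivAt_cos φ
  have h1 := (hs.mul hco).const_mul (1 - c)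
  have h2 := ((hco.pow 2).const_mul c).add (hs.pow 2)
  have h3 := (((hasDerivAt_id φ).add (h1.div h2 hden.ne').arctan)).div_const c
  refine h3.congr_deriv ?_
  simp only [Pi.add_apply, Pi.mul_apply, Pi.pow_apply, Pi.div_apply]
  set s := Real.sin φ
  set k := Real.cos φ
  have e1 : 1 + ((1 - c) * (s * k) / (c * k ^ 2 + s ^ 2)) ^ 2 =
      (s ^ 2 + c ^ 2 * k ^ 2) / (c * k ^ 2 + s ^ 2) ^ 2 := by
    field_simp
    linear_combination (s ^ 2 + c ^ 2 * k ^ 2) * hsc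
  rw [e1]
  field_simp
  push_cast
  simp only [pow_one]
  linear_combination ((1 - c) * (c * k ^ 2 - s ^ 2) + c) * hsc

lemma lintegral_angular {k : ℝ} (hk : 0 ≤ k) {x : ℂ} (hx : ‖x‖ < 1) :
    ∫⁻ θ in Ico 0 (2 * Real.pi), ENNReal.ofReal
      (k / (gap x * (1 - (x.re * Real.cos θ + x.im * Real.sin θ) ^ 2))) =
    ENNReal.ofReal (k * (2 * Real.pi) * density x) := by
  have hg := gap_pos hx
  set c := √(gap x) with hcdef
  have hc : 0 < c := Real.sqrt_pos.2 hg
  have hcc : c ^ 2 = gap x := Real.sq_sqrt hg.le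
  set χ := x.arg with hχ
  have hre : x.re = ‖x‖ * Real.cos χ := (Complex.norm_mul_cos_arg x).symm
  have him : x.im = ‖x‖ * Real.sin χ := (Complex.norm_mul_sin_arg x).symm
  have hden : ∀ θ, 1 - (x.re * Real.cos θ + x.im * Real.sin θ) ^ 2 =
      Real.sin (θ - χ) ^ 2 + c ^ 2 * Real.cos (θ - χ) ^ 2 := by
    intro θ
    have : x.re * Real.cos θ + x.im * Real.sin θ = ‖x‖ * Real.cos (θ - χ) := by
      rw [Real.cos_sub]; nth_rewrite 1 [hre, him]; ring
    rw [this, hcc, ← gap_eq]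
    linear_combination -Real.sin_sq_add_cos_sq (θ - χ)
  have hpos : ∀ φ, 0 < Real.sin φ ^ 2 + c ^ 2 * Real.cos φ ^ 2 := by
    intro φ
    have hsc := Real.sin_sq_add_cos_sq φ
    rcases (sq_nonneg (Real.sin φ)).eq_or_lt with h | h
    · rw [← h] at hsc ⊢; nlinarith [sq_pos_of_pos hc]
    · positivity
  have hder : ∀ θ ∈ uIcc 0 (2 * Real.pi), HasDerivAt (fun θ => k / gap x *
      ((θ - χ + Real.arctan ((1 - c) * (Real.sin (θ - χ) * Real.cos (θ - χ)) /
      (c * Real.cos (θ - χ) ^ 2 + Real.sin (θ - χ) ^ 2))) / c))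
      (k / (gap x * (1 - (x.re * Real.cos θ + x.im * Real.sin θ) ^ 2))) θ := by
    intro θ _
    have := (((hasDerivAt_angular hc (θ - χ)).comp θ ((hasDerivAt_id θ).sub_const χ))).const_mul
      (k / gap x)
    refine this.congr_deriv ?_
    rw [hden, mul_one, div_mul_div_comm, mul_one]
  have hcont : Continuous fun θ =>
      k / (gap x * (1 - (x.re * Real.cos θ + x.im * Real.sin θ) ^ 2)) := by
    refine Continuous.div (by fun_prop) (by fun_prop) fun θ => ?_
    have := hpos (θ - χ)
    rw [hden]; positivity
  have hval := intervalIntegral.integral_eq_sub_of_hasDerivAt hder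
    (hcont.intervalIntegrable _ _)
  have hp : (0 : ℝ) ≤ 2 * Real.pi := by positivity
  rw [intervalIntegral.integral_of_le hp, ← integral_Ico_eq_integral_Ioc] at hval
  rw [← ofReal_integral_eq_lintegral_ofReal, hval]
  · congr 1
    -- Over a full turn the periodic correction cancels, and only the linear term contributes.
    rw [show 2 * Real.pi - χ = 0 - χ + 2 * Real.pi by ring, Real.sin_add_two_pi,
      Real.cos_add_two_pi, density, ← hcdef]
    field_simp
    ring
  · exact (hcont.continuousOn.integrableOn_compact isCompact_Icc).mono_set Ico_subset_Icc_self
  · refine ae_of_all _ fun θ => ?_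
    have := hpos (θ - χ)
    simp only [Pi.zero_apply]
    rw [hden]; positivity

/-- The total integral of the chords of a compact region. -/
theorem lintegral_chord {L G ε : ℝ} (hL : 0 < L) (hG : 0 < G) (hε : 0 < ε) (hQc : IsCompact Q)
    (hQ : ∀ x ∈ Q, ‖x‖ < 1) :
    ∫⁻ γ in kinematicSpace, ENNReal.ofReal (chord L Q γ * croftonDensity L G ε γ) =
      ENNReal.ofReal (Real.pi / (2 * G) * (L ^ 2 * ∫ x in Q, density x)) := by
  have hKm : MeasurableSet kinematicSpace := measurableSet_Ico.prod measurableSet_Ioo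
  have hmeas : Measurable fun γ : ℝ × ℝ => ∫⁻ t in Ioo (0 : ℝ) 1, chordKernel L G Q γ t :=
    (measurable_chordKernel L G hQc).lintegral_prod_right'
  rw [setLIntegral_congr_fun hKm fun γ hγ => ofReal_chord_mul hL hG hε hQc hQ hγ,
    kinematicSpace, Measure.volume_eq_prod, ← Measure.prod_restrict,
    lintegral_prod _ hmeas.aemeasurable]
  simp only [lintegral_chordKernel L G hG hQc hQ]
  rw [lintegral_lintegral_swap (by unfold gap; fun_prop),
    setLIntegral_congr_fun hQc.measurableSet fun x hx => lintegral_angular (by positivity) (hQ x hx),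
    ← ofReal_integral_eq_lintegral_ofReal, ← integral_const_mul, ← integral_const_mul]
  · congr 1
    refine integral_congr_ae (ae_of_all _ fun x => ?_)
    simp only
    field_simp
    ring
  · exact ((continuousOn_density.mono hQ).integrableOn_compact hQc).const_mul _
  · refine (ae_restrict_iff' hQc.measurableSet).2 (ae_of_all _ fun x hx => ?_)
    have := density_nonneg (hQ x hx)
    have := Real.pi_pos
    simp only [Pi.zero_apply]
    positivity

lemma chord_mul_nonneg {L G ε : ℝ} (hL : 0 < L) (hG : 0 < G) (hε : 0 < ε) {γ : ℝ × ℝ}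
    (hγ : γ ∈ kinematicSpace) : 0 ≤ chord L Q γ * croftonDensity L G ε γ := by
  rw [croftonDensity_eq L G hε hγ]
  have := chord_nonneg (Q := Q) L γ
  positivity

theorem integrableOn_chord {L G ε : ℝ} (hL : 0 < L) (hG : 0 < G) (hε : 0 < ε) (hQc : IsCompact Q)
    (hQ : ∀ x ∈ Q, ‖x‖ < 1) :
    IntegrableOn (fun γ => chord L Q γ * croftonDensity L G ε γ) kinematicSpace := by
  have hKm : MeasurableSet kinematicSpace := measurableSet_Ico.prod measurableSet_Ioo
  have hmeas : Measurable fun γ : ℝ × ℝ => ∫⁻ t in Ioo (0 : ℝ) 1, chordKernel L G Q γ t :=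
    (measurable_chordKernel L G hQc).lintegral_prod_right'
  have haem : AEMeasurable (fun γ => chord L Q γ * croftonDensity L G ε γ)
      (volume.restrict kinematicSpace) := by
    refine ⟨_, hmeas.ennreal_toReal, (ae_restrict_iff' hKm).2 (ae_of_all _ fun γ hγ => ?_)⟩
    beta_reduce
    rw [← ofReal_chord_mul hL hG hε hQc hQ hγ,
      ENNReal.toReal_ofReal (chord_mul_nonneg hL hG hε hγ)]
  refine ⟨haem.aestronglyMeasurable, ?_⟩
  rw [hasFiniteIntegral_iff_ofReal ((ae_restrict_iff' hKm).2 (ae_of_all _ fun γ hγ =>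
    chord_mul_nonneg hL hG hε hγ)), lintegral_chord hL hG hε hQc hQ]
  exact ENNReal.ofReal_lt_top

/-- The Crofton formula for the area. -/
theorem integral_chord {L G ε : ℝ} (hL : 0 < L) (hG : 0 < G) (hε : 0 < ε) (hQc : IsCompact Q)
    (hQ : ∀ x ∈ Q, ‖x‖ < 1) :
    ∫ γ in kinematicSpace, chord L Q γ * croftonDensity L G ε γ =
      Real.pi / (2 * G) * (L ^ 2 * ∫ x in Q, density x) := by
  have hKm : MeasurableSet kinematicSpace := measurableSet_Ico.prod measurableSet_Ioo
  rw [integral_eq_lintegral_of_nonneg_ae ((ae_restrict_iff' hKm).2 (ae_of_all _ fun γ hγ =>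
    chord_mul_nonneg hL hG hε hγ)) (integrableOn_chord hL hG hε hQc hQ).aestronglyMeasurable,
    lintegral_chord hL hG hε hQc hQ, ENNReal.toReal_ofReal]
  have : 0 ≤ ∫ x in Q, density x :=
    setIntegral_nonneg hQc.measurableSet fun x hx => density_nonneg (hQ x hx)
  have := Real.pi_pos
  positivity

end crofton

/-! ### Sectors -/

/-- The signed distance of `x` to the geodesic `γ`, positive on its right. -/
def lineForm (γ : ℝ × ℝ) (x : ℂ) : ℝ :=
  x.re * Real.cos γ.1 + x.im * Real.sin γ.1 - Real.cos γ.2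

lemma geodesic_re (γ : ℝ × ℝ) (t : ℝ) : (geodesic γ t).re =
    Real.cos γ.1 * Real.cos γ.2 - Real.sin γ.1 * ((2 * t - 1) * Real.sin γ.2) := by
  rw [geodesic_eq, mul_re, exp_ofReal_mul_I_re, exp_ofReal_mul_I_im]

lemma geodesic_im (γ : ℝ × ℝ) (t : ℝ) : (geodesic γ t).im =
    Real.cos γ.1 * ((2 * t - 1) * Real.sin γ.2) + Real.sin γ.1 * Real.cos γ.2 := by
  rw [geodesic_eq, mul_im, exp_ofReal_mul_I_re, exp_ofReal_mul_I_im]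

lemma lineForm_geodesic (γ : ℝ × ℝ) (t : ℝ) : lineForm γ (geodesic γ t) = 0 := by
  rw [lineForm, geodesic_re, geodesic_im]
  linear_combination Real.cos γ.2 * Real.sin_sq_add_cos_sq γ.1

lemma lineForm_combo (γ : ℝ × ℝ) (x y : ℂ) {s t : ℝ} (h : s + t = 1) :
    lineForm γ (s • x + t • y) = s * lineForm γ x + t * lineForm γ y := by
  obtain rfl : s = 1 - t := by linarith
  simp only [lineForm, add_re, add_im, real_smul, re_ofReal_mul, im_ofReal_mul]; ring

lemma continuous_lineForm (x : ℂ) : Continuous fun γ => lineForm γ x := by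
  unfold lineForm; fun_prop

lemma exists_geodesic_eq {γ : ℝ × ℝ} (hγ : γ ∈ kinematicSpace) {x : ℂ} (hx : ‖x‖ < 1)
    (h : lineForm γ x = 0) : ∃ t ∈ Ioo (0 : ℝ) 1, geodesic γ t = x := by
  have hsc := Real.sin_sq_add_cos_sq γ.1
  have hg := gap_pos hx
  have h1 : x.re * Real.cos γ.1 + x.im * Real.sin γ.1 = Real.cos γ.2 := by
    rw [lineForm] at h; linarith
  have hmem : (Real.cos γ.2, x.im * Real.cos γ.1 - x.re * Real.sin γ.1) ∈
      {y : ℝ × ℝ | y.1 ^ 2 + y.2 ^ 2 < 1} := by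
    simp only [mem_ofPred_eq, ← h1]
    have : (x.re * Real.cos γ.1 + x.im * Real.sin γ.1) ^ 2 +
        (x.im * Real.cos γ.1 - x.re * Real.sin γ.1) ^ 2 = 1 - gap x := by
      unfold gap
      linear_combination (x.re ^ 2 + x.im ^ 2) * hsc
    linarith
  rw [← chordMap_image] at hmem
  obtain ⟨⟨α, t⟩, ⟨hα, ht⟩, heq⟩ := hmem
  simp only [chordMap, Prod.mk.injEq] at heq
  obtain rfl : α = γ.2 :=
    Real.injOn_cos (Ioo_subset_Icc_self hα) (Ioo_subset_Icc_self hγ.2) heq.1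
  refine ⟨t, ht, Complex.ext ?_ ?_⟩
  · rw [geodesic_re, heq.2, ← h1]
    linear_combination x.re * hsc
  · rw [geodesic_im, heq.2, ← h1]
    linear_combination x.im * hsc

/-- For each `θ`, at most one `α` in `(0, π)` has the required cosine, so all slices are null. -/
lemma volume_lineForm_eq_zero (x : ℂ) :
    volume {γ | γ ∈ kinematicSpace ∧ lineForm γ x = 0} = 0 := by
  have hm : MeasurableSet {γ | γ ∈ kinematicSpace ∧ lineForm γ x = 0} :=
    (measurableSet_Ico.prod measurableSet_Ioo).inter
      ((continuous_lineForm x).measurable (measurableSet_singleton 0))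
  rw [Measure.volume_eq_prod, Measure.measure_prod_null hm]
  refine ae_of_all _ fun θ => Set.Subsingleton.measure_zero ?_ _
  rintro α ⟨hα, h⟩ α' ⟨hα', h'⟩
  refine Real.injOn_cos (Ioo_subset_Icc_self hα.2) (Ioo_subset_Icc_self hα'.2) ?_
  simp only [lineForm] at h h'
  linarith

/-! ### Entry and exit edges, and the decomposition into sectors -/

section polygon

variable {m : ℕ} {L : ℝ} {p : Fin (m + 1) → ℂ}

/-- The geodesics through a vertex. -/
def vertexGeodesics {e : ℕ} (p : Fin e → ℂ) : Set (ℝ × ℝ) :=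
  ⋃ k, {γ | γ ∈ kinematicSpace ∧ lineForm γ (p k) = 0}

lemma volume_vertexGeodesics {e : ℕ} (p : Fin e → ℂ) : volume (vertexGeodesics p) = 0 :=
  measure_iUnion_null fun k => volume_lineForm_eq_zero (p k)

lemma mem_vertexGeodesics {e : ℕ} {p : Fin e → ℂ} {γ : ℝ × ℝ} (hγ : γ ∈ kinematicSpace) {t : ℝ}
    (h : geodesic γ t ∈ range p) : γ ∈ vertexGeodesics p := by
  obtain ⟨k, hk⟩ := h
  exact mem_iUnion.2 ⟨k, hγ, by rw [hk, lineForm_geodesic]⟩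

/-- The rate at which a geodesic moves to the left of an edge. -/
def slope {e : ℕ} (p : Fin e → ℂ) (γ : ℝ × ℝ) (i : Fin e) : ℝ :=
  lineForm γ (p (finRotate e i)) - lineForm γ (p i)

/-- Chords are straight, so `side` is affine along them; as `sin α > 0`, the sign of `slope` tells
in which direction the line of an edge is crossed. -/
lemma side_geodesic {e : ℕ} (p : Fin e → ℂ) (γ : ℝ × ℝ) (i : Fin e) (s t : ℝ) :
    side p i (geodesic γ t) =
      side p i (geodesic γ s) + (t - s) * (2 * Real.sin γ.2 * slope p γ i) := by
  simp only [side, cross_def, slope, lineForm, sub_re, sub_im, geodesic_re, geodesic_im]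
  ring

lemma eventually_side_nonneg {e : ℕ} {p : Fin e → ℂ} {γ : ℝ × ℝ} {i : Fin e} {s : ℝ}
    (h : 0 < side p i (geodesic γ s)) :
    ∀ᶠ t in nhds s, 0 ≤ side p i (geodesic γ t) := by
  have hc : Continuous fun t => side p i (geodesic γ t) :=
    (continuous_cross_sub _ _).comp (continuous_geodesic_right γ)
  filter_upwards [hc.continuousAt.eventually (lt_mem_nhds h)] with t ht using ht.le

/-- A geodesic enters the polygon through an edge which it crosses to the left. -/
lemma exists_entry_edge (hm : 2 ≤ m) (hp : IsConvexPolygon p) {γ : ℝ × ℝ}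
    (hγ : γ ∈ kinematicSpace) {s : ℝ} (hs : IsLeast (times (region p) γ) s) :
    ∃ i, geodesic γ s ∈ edge p i ∧ 0 < slope p γ i := by
  have hsin : 0 < Real.sin γ.2 := Real.sin_pos_of_pos_of_lt_pi hγ.2.1 hγ.2.2
  -- If no edge touched at time `s` were crossed to the left, then slightly earlier points would
  -- still lie in all half planes, hence in the polygon, and `s` would not be the least time.
  by_contra! hcon
  have hev : ∀ᶠ t in nhdsWithin s (Iio s), ∀ i, 0 ≤ side p i (geodesic γ t) := by
    rw [Filter.eventually_all]
    intro i
    rcases (hp.side_nonneg i hs.1.2).eq_or_lt with h0 | h0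
    · have hsl := hcon i (hp.mem_edge hs.1.2 h0.symm)
      filter_upwards [self_mem_nhdsWithin] with t ht
      rw [side_geodesic p γ i s t, ← h0, zero_add]
      have ht' : t - s ≤ 0 := by linarith [show t < s from ht]
      exact mul_nonneg_of_nonpos_of_nonpos ht'
        (mul_nonpos_of_nonneg_of_nonpos (by positivity) hsl)
    · exact (eventually_side_nonneg h0).filter_mono nhdsWithin_le_nhds
  have hev2 : ∀ᶠ t in nhdsWithin s (Iio s), t ∈ Ioo (0 : ℝ) 1 :=
    nhdsWithin_le_nhds (Ioo_mem_nhds hs.1.1.1 hs.1.1.2)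
  obtain ⟨t, ht1, ht2, ht3⟩ := (hev.and (hev2.and self_mem_nhdsWithin)).exists
  refine absurd (hs.2 ⟨ht2, ?_⟩) (not_le.2 ht3)
  rw [(hp.region_eq hm).2]
  exact ht1

lemma exists_exit_edge (hm : 2 ≤ m) (hp : IsConvexPolygon p) {γ : ℝ × ℝ}
    (hγ : γ ∈ kinematicSpace) {s : ℝ} (hs : IsGreatest (times (region p) γ) s) :
    ∃ i, geodesic γ s ∈ edge p i ∧ slope p γ i < 0 := by
  have hsin : 0 < Real.sin γ.2 := Real.sin_pos_of_pos_of_lt_pi hγ.2.1 hγ.2.2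
  by_contra! hcon
  have hev : ∀ᶠ t in nhdsWithin s (Ioi s), ∀ i, 0 ≤ side p i (geodesic γ t) := by
    rw [Filter.eventually_all]
    intro i
    rcases (hp.side_nonneg i hs.1.2).eq_or_lt with h0 | h0
    · have hsl := hcon i (hp.mem_edge hs.1.2 h0.symm)
      filter_upwards [self_mem_nhdsWithin] with t ht
      rw [side_geodesic p γ i s t, ← h0, zero_add]
      have ht' : 0 ≤ t - s := by linarith [show s < t from ht]
      positivity
    · exact (eventually_side_nonneg h0).filter_mono nhdsWithin_le_nhds
  have hev2 : ∀ᶠ t in nhdsWithin s (Ioi s), t ∈ Ioo (0 : ℝ) 1 :=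
    nhdsWithin_le_nhds (Ioo_mem_nhds hs.1.1.1 hs.1.1.2)
  obtain ⟨t, ht1, ht2, ht3⟩ := (hev.and (hev2.and self_mem_nhdsWithin)).exists
  refine absurd (hs.2 ⟨ht2, ?_⟩) (not_le.2 ht3)
  rw [(hp.region_eq hm).2]
  exact ht1

theorem geodesicsMeeting_eq (hm : 2 ≤ m) (hp : IsRightAngledPolygon L p) :
    geodesicsMeeting (region p) = ⋃ (i) (j) (_ : i ≠ j), sector p i j := by
  have hQ : ∀ x ∈ region p, ‖x‖ < 1 := fun x hx => norm_lt_one_of_mem_region hp hx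
  have hc := hp.isConvexPolygon
  ext γ
  simp only [mem_iUnion, exists_prop]
  constructor
  · rintro ⟨hγ, _, ⟨t, ht, rfl⟩, htQ⟩
    have hcomp := isCompact_times (isCompact_region p) hQ γ
    have hne : (times (region p) γ).Nonempty := ⟨t, ht, htQ⟩
    obtain ⟨a, ha⟩ := hcomp.exists_isLeast hne
    obtain ⟨b, hb⟩ := hcomp.exists_isGreatest hne
    obtain ⟨i, hi, hi'⟩ := exists_entry_edge hm hc hγ ha
    obtain ⟨j, hj, hj'⟩ := exists_exit_edge hm hc hγ hb
    -- The entry and exit edges have slopes of opposite signs, so they differ.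
    exact ⟨i, j, by rintro rfl; linarith, hγ, ⟨a, ha, hi⟩, b, hb, hj⟩
  · rintro ⟨i, j, -, hγ, ⟨a, ha, -⟩, -⟩
    exact ⟨hγ, _, ⟨a, ha.1.1, rfl⟩, ha.1.2⟩

/-- The entry and exit points are determined by the geodesic. If it lies in two sectors, one of
these points is on two edges and is therefore a vertex. -/
theorem sector_aedisjoint (hm : 2 ≤ m) (hp : IsRightAngledPolygon L p) {i j k l : Fin (m + 1)}
    (h : (i, j) ≠ (k, l)) : AEDisjoint volume (sector p i j) (sector p k l) := by
  refine measure_mono_null ?_ (volume_vertexGeodesics p)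
  rintro γ ⟨⟨hγ, ⟨a, ha, hi⟩, b, hb, hj⟩, -, ⟨a', ha', hk⟩, b', hb', hl⟩
  obtain rfl := ha.unique ha'
  obtain rfl := hb.unique hb'
  have hc := hp.isConvexPolygon
  by_cases hik : i = k
  · have hjl : j ≠ l := by rintro rfl; exact h (by rw [hik])
    exact mem_vertexGeodesics hγ (hc.mem_range_of_mem_edges (by omega) hjl hj hl)
  · exact mem_vertexGeodesics hγ (hc.mem_range_of_mem_edges (by omega) hik hi hk)

/-- The geodesics that separate the end points of the `i`-th edge and those of the `j`-th edge, in
the order of the polygon for the first and in the opposite order for the second. -/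
def openSector {e : ℕ} (p : Fin e → ℂ) (i j : Fin e) : Set (ℝ × ℝ) :=
  {γ | γ ∈ kinematicSpace ∧ (lineForm γ (p i) < 0 ∧ 0 < lineForm γ (p (finRotate e i))) ∧
    (0 < lineForm γ (p j) ∧ lineForm γ (p (finRotate e j)) < 0)}

lemma measurableSet_openSector {e : ℕ} (p : Fin e → ℂ) (i j : Fin e) :
    MeasurableSet (openSector p i j) := by
  have h : ∀ x, Measurable fun γ => lineForm γ x := fun x => (continuous_lineForm x).measurable
  refine (measurableSet_Ico.prod measurableSet_Ioo).inter (MeasurableSet.inter ?_ ?_)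
  · exact (measurableSet_lt (h _) measurable_const).inter (measurableSet_lt measurable_const (h _))
  · exact (measurableSet_lt measurable_const (h _)).inter (measurableSet_lt (h _) measurable_const)

lemma exists_geodesic_mem_edge (hp : IsRightAngledPolygon L p) {γ : ℝ × ℝ}
    (hγ : γ ∈ kinematicSpace) {i : Fin (m + 1)}
    (h : lineForm γ (p i) * lineForm γ (p (finRotate _ i)) < 0) :
    ∃ s ∈ times (region p) γ, geodesic γ s ∈ edge p i := by
  set a := lineForm γ (p i) with ha
  set b := lineForm γ (p (finRotate _ i)) with hb
  have hne : b - a ≠ 0 := fun h0 => by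
    rw [sub_eq_zero.1 h0] at h
    exact absurd h (not_lt.2 (mul_self_nonneg a))
  have h1 : b / (b - a) + -a / (b - a) = 1 := by field_simp; ring
  have h2 : 0 ≤ b / (b - a) := by
    rw [← mul_div_mul_right b (b - a) hne]
    refine div_nonneg ?_ (mul_self_nonneg _)
    nlinarith [mul_self_nonneg b]
  have h3 : 0 ≤ -a / (b - a) := by
    rw [← mul_div_mul_right (-a) (b - a) hne]
    refine div_nonneg ?_ (mul_self_nonneg _)
    nlinarith [mul_self_nonneg a]
  have hx : (b / (b - a)) • p i + (-a / (b - a)) • p (finRotate _ i) ∈ edge p i :=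
    ⟨_, _, h2, h3, h1, rfl⟩
  have hxr := edge_subset_region i hx
  obtain ⟨t, ht, heq⟩ := exists_geodesic_eq hγ (norm_lt_one_of_mem_region hp hxr)
    (by rw [lineForm_combo γ _ _ h1, ← ha, ← hb]; ring)
  exact ⟨t, ⟨ht, by rwa [heq]⟩, by rwa [heq]⟩

/-- The signs give edge `i` positive slope and edge `j` negative slope: before the crossing of `i`
and after that of `j` the geodesic is outside a supporting half plane. -/
lemma openSector_subset_sector (hp : IsRightAngledPolygon L p) (i j : Fin (m + 1)) :
    openSector p i j ⊆ sector p i j := by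
  rintro γ ⟨hγ, ⟨hi1, hi2⟩, hj1, hj2⟩
  have hsin : 0 < Real.sin γ.2 := Real.sin_pos_of_pos_of_lt_pi hγ.2.1 hγ.2.2
  have hc := hp.isConvexPolygon
  obtain ⟨a, ha, hai⟩ := exists_geodesic_mem_edge hp hγ (mul_neg_of_neg_of_pos hi1 hi2)
  obtain ⟨b, hb, hbj⟩ := exists_geodesic_mem_edge hp hγ (mul_neg_of_pos_of_neg hj1 hj2)
  refine ⟨hγ, ⟨a, ⟨ha, fun t ht => ?_⟩, hai⟩, b, ⟨hb, fun t ht => ?_⟩, hbj⟩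
  · have h1 := hc.side_nonneg i ht.2
    rw [side_geodesic p γ i a t, side_eq_zero_of_mem_edge hai, zero_add] at h1
    have hsl : 0 < 2 * Real.sin γ.2 * slope p γ i := by
      have : 0 < slope p γ i := by rw [slope]; linarith
      positivity
    have := nonneg_of_mul_nonneg_left h1 hsl
    linarith
  · have h1 := hc.side_nonneg j ht.2
    rw [side_geodesic p γ j b t, side_eq_zero_of_mem_edge hbj, zero_add] at h1
    have hsl : 0 < 2 * Real.sin γ.2 * -slope p γ j := by
      have : 0 < -slope p γ j := by rw [slope]; linarith
      positivity
    have := nonneg_of_mul_nonneg_left (show 0 ≤ (b - t) * (2 * Real.sin γ.2 * -slope p γ j) by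
      linarith) hsl
    linarith

lemma lineForm_of_mem_edge {e : ℕ} {p : Fin e → ℂ} {γ : ℝ × ℝ} (hγ : γ ∈ kinematicSpace)
    (hv : γ ∉ vertexGeodesics p) {i : Fin e} {s : ℝ} (hs : geodesic γ s ∈ edge p i) :
    lineForm γ (p i) * lineForm γ (p (finRotate e i)) < 0 := by
  have hne : ∀ k, lineForm γ (p k) ≠ 0 := fun k h => hv (mem_iUnion.2 ⟨k, hγ, h⟩)
  obtain ⟨x, y, hx, hy, hxy, heq⟩ := hs
  have h0 := lineForm_geodesic γ s
  rw [← heq, lineForm_combo γ _ _ hxy] at h0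
  have h1 := hne i
  have h2 := hne (finRotate e i)
  set a := lineForm γ (p i)
  set b := lineForm γ (p (finRotate e i))
  by_contra hcon
  have hab : 0 < a * b := lt_of_le_of_ne (not_lt.1 hcon) (mul_ne_zero h1 h2).symm
  have h3 : x * (a * a) + y * (a * b) = 0 := by linear_combination a * h0
  have h4 : 0 < a * a := mul_self_pos.2 h1
  have h5 := mul_nonneg hx h4.le
  have h6 := mul_nonneg hy hab.le
  have hx0 : x = 0 := by
    have : x * (a * a) = 0 := by linarith
    exact (mul_eq_zero.1 this).resolve_right h4.ne'
  have hy0 : y = 0 := by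
    have : y * (a * b) = 0 := by linarith
    exact (mul_eq_zero.1 this).resolve_right hab.ne'
  linarith

/-- This supplies the measurability of sectors, whose definition by first and last times does not
show it. Off the vertex geodesics, the entry and exit edges are unique and the signs of their slopes
fix those of `lineForm` at their ends. -/
lemma sector_ae_eq (hm : 2 ≤ m) (hp : IsRightAngledPolygon L p) (i j : Fin (m + 1)) :
    sector p i j =ᵐ[volume] openSector p i j := by
  refine ae_eq_set.2 ⟨measure_mono_null ?_ (volume_vertexGeodesics p), ?_⟩
  · rintro γ ⟨⟨hγ, ⟨a, ha, hi⟩, b, hb, hj⟩, hnot⟩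
    by_contra hv
    have hc := hp.isConvexPolygon
    obtain ⟨i', hi1, hi2⟩ := exists_entry_edge hm hc hγ ha
    obtain ⟨j', hj1, hj2⟩ := exists_exit_edge hm hc hγ hb
    have hii : i = i' := by
      by_contra h
      exact hv (mem_vertexGeodesics hγ (hc.mem_range_of_mem_edges (by omega) h hi hi1))
    have hjj : j = j' := by
      by_contra h
      exact hv (mem_vertexGeodesics hγ (hc.mem_range_of_mem_edges (by omega) h hj hj1))
    subst hii hjj
    have h1 := lineForm_of_mem_edge hγ hv hi
    have h2 := lineForm_of_mem_edge hγ hv hj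
    rw [slope] at hi2 hj2
    refine hnot ⟨hγ, ?_, ?_⟩
    · rcases mul_neg_iff.1 h1 with h | h
      · linarith [h.1, h.2]
      · exact h
    · rcases mul_neg_iff.1 h2 with h | h
      · exact h
      · linarith [h.1, h.2]
  · rw [sdiff_eq_empty.2 (openSector_subset_sector hp i j), measure_empty]

lemma nullMeasurableSet_sector (hm : 2 ≤ m) (hp : IsRightAngledPolygon L p) (i j : Fin (m + 1)) :
    NullMeasurableSet (sector p i j) :=
  (measurableSet_openSector p i j).nullMeasurableSet.congr (sector_ae_eq hm hp i j).symm

end polygon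

/-! ### Reversal of orientation -/

/-- The reversal of orientation, up to a full turn. -/
def reversal : ℝ × ℝ ≃ᵐ ℝ × ℝ :=
  (MeasurableEquiv.addRight Real.pi).prodCongr (MeasurableEquiv.subLeft Real.pi)

lemma reversal_apply (γ : ℝ × ℝ) : reversal γ = (γ.1 + Real.pi, Real.pi - γ.2) := rfl

lemma measurePreserving_reversal : MeasurePreserving reversal :=
  (measurePreserving_add_right volume Real.pi).prod (Measure.measurePreserving_sub_left volume Real.pi)

lemma geodesic_reversal (γ : ℝ × ℝ) (t : ℝ) :
    geodesic (reversal γ) t = geodesic γ (1 - t) := by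
  rw [reversal_apply]
  apply Complex.ext
  · simp only [geodesic_re, Real.cos_add_pi, Real.sin_add_pi, Real.cos_pi_sub, Real.sin_pi_sub]
    ring
  · simp only [geodesic_im, Real.cos_add_pi, Real.sin_add_pi, Real.cos_pi_sub, Real.sin_pi_sub]
    ring

lemma mem_times_reversal (Q : Set ℂ) (γ : ℝ × ℝ) (t : ℝ) :
    t ∈ times Q (reversal γ) ↔ 1 - t ∈ times Q γ := by
  simp only [times, mem_ofPred_eq, geodesic_reversal, mem_Ioo]
  refine and_congr_left fun _ => ?_
  constructor <;> rintro ⟨h1, h2⟩ <;> constructor <;> linarith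

lemma isLeast_times_reversal {Q : Set ℂ} {γ : ℝ × ℝ} {t : ℝ} :
    IsLeast (times Q (reversal γ)) t ↔ IsGreatest (times Q γ) (1 - t) := by
  refine and_congr (mem_times_reversal Q γ t) ⟨fun h s hs => ?_, fun h s hs => ?_⟩
  · have := h ((mem_times_reversal Q γ (1 - s)).2 (by simpa using hs))
    linarith
  · have := h ((mem_times_reversal Q γ s).1 hs)
    linarith

lemma isGreatest_times_reversal {Q : Set ℂ} {γ : ℝ × ℝ} {t : ℝ} :
    IsGreatest (times Q (reversal γ)) t ↔ IsLeast (times Q γ) (1 - t) := by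
  refine and_congr (mem_times_reversal Q γ t) ⟨fun h s hs => ?_, fun h s hs => ?_⟩
  · have := h ((mem_times_reversal Q γ (1 - s)).2 (by simpa using hs))
    linarith
  · have := h ((mem_times_reversal Q γ s).1 hs)
    linarith

lemma exists_one_sub {P : ℝ → Prop} : (∃ t, P (1 - t)) ↔ ∃ t, P t :=
  ⟨fun ⟨t, h⟩ => ⟨_, h⟩, fun ⟨t, h⟩ => ⟨1 - t, by simpa using h⟩⟩

lemma reversal_mem_sector {e : ℕ} (p : Fin e → ℂ) (i j : Fin e) {γ : ℝ × ℝ}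
    (hγ : γ ∈ kinematicSpace) (hγ' : reversal γ ∈ kinematicSpace) :
    reversal γ ∈ sector p j i ↔ γ ∈ sector p i j := by
  simp only [sector, mem_ofPred_eq, isLeast_times_reversal, isGreatest_times_reversal,
    geodesic_reversal, hγ, hγ', true_and]
  rw [exists_one_sub (P := fun t => IsGreatest (times (region p) γ) t ∧ geodesic γ t ∈ edge p j),
    exists_one_sub (P := fun t => IsLeast (times (region p) γ) t ∧ geodesic γ t ∈ edge p i),
    and_comm]

/-- Adding `π` keeps `θ` in `[0, 2π)` only on the half `θ < π`, which is carried onto the other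
half. Symmetry is therefore proved half by half, with no reduction modulo `2 * π`. -/
lemma reversal_mem_kinematicSpace (γ : ℝ × ℝ) :
    reversal γ ∈ kinematicSpace ∩ {γ | γ.1 < Real.pi}ᶜ ↔
      γ ∈ kinematicSpace ∩ {γ | γ.1 < Real.pi} := by
  simp only [reversal_apply, kinematicSpace, mem_inter_iff, mem_prod, mem_Ico, mem_Ioo,
    mem_compl_iff, mem_ofPred_eq, not_lt]
  have := Real.pi_pos
  constructor
  · rintro ⟨⟨⟨h1, h2⟩, h3, h4⟩, h5⟩
    refine ⟨⟨⟨?_, ?_⟩, ?_, ?_⟩, ?_⟩ <;> linarith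
  · rintro ⟨⟨⟨h1, h2⟩, h3, h4⟩, h5⟩
    refine ⟨⟨⟨?_, ?_⟩, ?_, ?_⟩, ?_⟩ <;> linarith

lemma preimage_reversal_sector {e : ℕ} (p : Fin e → ℂ) (i j : Fin e) :
    reversal ⁻¹' (sector p j i ∩ {γ | γ.1 < Real.pi}ᶜ) = sector p i j ∩ {γ | γ.1 < Real.pi} := by
  ext γ
  have hK := reversal_mem_kinematicSpace γ
  constructor
  · rintro ⟨h1, h2⟩
    have h3 := hK.1 ⟨h1.1, h2⟩
    exact ⟨(reversal_mem_sector p i j h3.1 h1.1).1 h1, h3.2⟩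
  · rintro ⟨h1, h2⟩
    have h3 := hK.2 ⟨h1.1, h2⟩
    exact ⟨(reversal_mem_sector p i j h1.1 h3.1).2 h1, h3.2⟩

lemma chord_reversal {L : ℝ} (hL : 0 < L) {Q : Set ℂ} (hQc : IsCompact Q)
    (hQ : ∀ x ∈ Q, ‖x‖ < 1) {γ : ℝ × ℝ} (hγ : γ ∈ kinematicSpace)
    (hγ' : reversal γ ∈ kinematicSpace) : chord L Q (reversal γ) = chord L Q γ := by
  rw [chord_eq hL hQc hQ hγ, chord_eq hL hQc hQ hγ']
  have h := (Measure.measurePreserving_sub_left (volume : Measure ℝ) 1).setIntegral_preimage_emb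
    (MeasurableEquiv.subLeft (1 : ℝ)).measurableEmbedding
    (fun t => L / (2 * (t * (1 - t)))) (times Q γ)
  rw [← h]
  have hset : times Q (reversal γ) = (fun t => 1 - t) ⁻¹' times Q γ := by
    ext t; exact mem_times_reversal Q γ t
  rw [hset]
  congr 1
  funext t
  rw [sub_sub_cancel, mul_comm t]

/-! ### Symmetry and sum of the sector integrals -/

section polygon

variable {m : ℕ} {L G ε : ℝ} {p : Fin (m + 1) → ℂ}

lemma integrableOn_weightedChord (hL : 0 < L) (hG : 0 < G) (hε : 0 < ε)
    (hp : IsRightAngledPolygon L p) : IntegrableOn (weightedChord L G ε p) kinematicSpace :=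
  integrableOn_chord hL hG hε (isCompact_region p) fun _ hx => norm_lt_one_of_mem_region hp hx

lemma integral_half_sector (hm : 2 ≤ m) (hL : 0 < L) (hε : 0 < ε)
    (hp : IsRightAngledPolygon L p) (i j : Fin (m + 1)) :
    ∫ γ in sector p i j ∩ {γ | γ.1 < Real.pi}, weightedChord L G ε p γ =
      ∫ γ in sector p j i ∩ {γ | γ.1 < Real.pi}ᶜ, weightedChord L G ε p γ := by
  rw [← measurePreserving_reversal.setIntegral_preimage_emb reversal.measurableEmbedding
    (weightedChord L G ε p) (sector p j i ∩ {γ | γ.1 < Real.pi}ᶜ), preimage_reversal_sector]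
  have hnull : NullMeasurableSet (sector p i j ∩ {γ | γ.1 < Real.pi}) :=
    (nullMeasurableSet_sector hm hp i j).inter
      (measurableSet_lt measurable_fst measurable_const).nullMeasurableSet
  refine integral_congr_ae ?_
  filter_upwards [ae_restrict_mem₀ hnull] with γ hγ
  have h' := ((reversal_mem_kinematicSpace γ).2 ⟨hγ.1.1, hγ.2⟩).1
  rw [weightedChord, weightedChord, chord_reversal hL (isCompact_region p)
    (fun _ hx => norm_lt_one_of_mem_region hp hx) hγ.1.1 h', croftonDensity_eq L G hε hγ.1.1,
    croftonDensity_eq L G hε h', reversal_apply, Real.sin_pi_sub]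

theorem sectorIntegral_comm (hm : 2 ≤ m) (hL : 0 < L) (hG : 0 < G) (hε : 0 < ε)
    (hp : IsRightAngledPolygon L p) (i j : Fin (m + 1)) :
    sectorIntegral L G ε p i j = sectorIntegral L G ε p j i := by
  have hmeas : MeasurableSet {γ : ℝ × ℝ | γ.1 < Real.pi} :=
    measurableSet_lt measurable_fst measurable_const
  have hintegral : ∀ i j, IntegrableOn (weightedChord L G ε p) (sector p i j) := fun i j =>
    (integrableOn_weightedChord hL hG hε hp).mono_set fun γ hγ => hγ.1
  -- Each half of `s_ij` corresponds to the opposite half of `s_ji`.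
  rw [sectorIntegral, sectorIntegral, ← integral_inter_add_sdiff hmeas (hintegral i j),
    ← integral_inter_add_sdiff hmeas (hintegral j i), sdiff_eq, sdiff_eq,
    integral_half_sector hm hL hε hp i j, integral_half_sector hm hL hε hp j i, add_comm]

lemma two_mul_sum_Ioi {e : ℕ} (f : Fin e → Fin e → ℝ) (hf : ∀ i j, f i j = f j i) :
    2 * ∑ i, ∑ j ∈ Finset.Ioi i, f i j = ∑ q : {q : Fin e × Fin e // q.1 ≠ q.2}, f q.1.1 q.1.2 := by
  have h1 : ∑ i, ∑ j ∈ Finset.Ioi i, f i j = ∑ i, ∑ j, if i < j then f i j else 0 := by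
    refine Finset.sum_congr rfl fun i _ => ?_
    rw [← Finset.sum_filter]
    refine Finset.sum_congr ?_ fun _ _ => rfl
    ext j; simp
  have h2 : ∑ i, ∑ j, (if i < j then f i j else 0) = ∑ i, ∑ j, if j < i then f i j else 0 := by
    rw [Finset.sum_comm]
    refine Finset.sum_congr rfl fun i _ => Finset.sum_congr rfl fun j _ => ?_
    rw [hf]
  have h3 : ∑ q : {q : Fin e × Fin e // q.1 ≠ q.2}, f q.1.1 q.1.2 =
      ∑ i, ∑ j, if i ≠ j then f i j else 0 := by
    rw [← Fintype.sum_prod_type' (f := fun i j => if i ≠ j then f i j else 0),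
      ← Finset.sum_filter]
    exact (Finset.sum_subtype _ (by simp) (fun q : Fin e × Fin e => f q.1 q.2)).symm
  rw [h3, h1, two_mul]
  nth_rewrite 2 [h2]
  rw [← Finset.sum_add_distrib]
  refine Finset.sum_congr rfl fun i _ => ?_
  rw [← Finset.sum_add_distrib]
  refine Finset.sum_congr rfl fun j _ => ?_
  rcases lt_trichotomy i j with h | h | h
  · simp [h, h.not_gt, h.ne]
  · simp [h]
  · simp [h.ne', h, h.not_gt]

/-- The sector integrals add up to the area. -/
theorem two_mul_sum_sectorIntegral (hm : 2 ≤ m) (hL : 0 < L) (hG : 0 < G) (hε : 0 < ε)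
    (hp : IsRightAngledPolygon L p) :
    2 * ∑ i, ∑ j ∈ Finset.Ioi i, sectorIntegral L G ε p i j = area L (region p) := by
  have hQ : ∀ x ∈ region p, ‖x‖ < 1 := fun x hx => norm_lt_one_of_mem_region hp hx
  have hQc := isCompact_region p
  have hKm : MeasurableSet kinematicSpace := measurableSet_Ico.prod measurableSet_Ioo
  have hunion : (⋃ q : {q : Fin (m + 1) × Fin (m + 1) // q.1 ≠ q.2}, sector p q.1.1 q.1.2) =
      geodesicsMeeting (region p) := by
    rw [geodesicsMeeting_eq hm hp]
    ext γ
    simp only [mem_iUnion, Subtype.exists, Prod.exists, exists_prop]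
  have hsum := hasSum_integral_iUnion_ae (μ := volume) (f := weightedChord L G ε p)
    (s := fun q : {q : Fin (m + 1) × Fin (m + 1) // q.1 ≠ q.2} => sector p q.1.1 q.1.2)
    (fun q => nullMeasurableSet_sector hm hp _ _)
    (fun q q' hqq => sector_aedisjoint hm hp fun h => hqq (Subtype.ext h))
    ((integrableOn_weightedChord hL hG hε hp).mono_set (iUnion_subset fun q γ hγ => hγ.1))
  have htotal := hsum.unique (hasSum_fintype _)
  rw [hunion] at htotal
  -- Geodesics that miss the polygon have chord zero, so the integral extends to all of kinematic
  -- space, where the Crofton formula applies.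
  have hzero : ∫ γ in kinematicSpace, weightedChord L G ε p γ =
      ∫ γ in geodesicsMeeting (region p), weightedChord L G ε p γ := by
    refine setIntegral_eq_of_subset_of_forall_sdiff_eq_zero hKm (fun γ hγ => hγ.1) ?_
    rintro γ ⟨hγ, hnot⟩
    have : times (region p) γ = ∅ := by
      rw [eq_empty_iff_forall_notMem]
      rintro t ⟨ht, htQ⟩
      exact hnot ⟨hγ, _, ⟨t, ht, rfl⟩, htQ⟩
    rw [weightedChord, chord, this]
    simp
  have hcrofton : ∫ γ in kinematicSpace, weightedChord L G ε p γ =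
      Real.pi / (2 * G) * (L ^ 2 * ∫ x in region p, density x) :=
    integral_chord hL hG hε hQc hQ
  rw [two_mul_sum_Ioi _ (sectorIntegral_comm hm hL hG hε hp)]
  simp only [sectorIntegral]
  rw [← Finset.mul_sum, ← htotal, ← hzero, hcrofton, area_eq hp]
  have := Real.pi_pos
  field_simp

end polygon

end

end KinematicSpace

open KinematicSpace in
theorem mainTheorem3 (n : ℕ) (hn : 2 ≤ n) (L G ε : ℝ) (hL : 0 < L) (hG : 0 < G) (hε : 0 < ε)
    (p : Fin (4 * (n - 1)) → ℂ) (hp : IsRightAngledPolygon L p) :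
    (geodesicsMeeting (region p) = ⋃ (i) (j) (_ : i ≠ j), sector p i j) ∧
    (∀ i j k l, i ≠ j → k ≠ l → (i, j) ≠ (k, l) →
      MeasureTheory.AEDisjoint MeasureTheory.volume (sector p i j) (sector p k l)) ∧
    (∀ i j, i ≠ j → MeasureTheory.IntegrableOn (weightedChord L G ε p) (sector p i j)) ∧
    (∀ i j, i ≠ j → sectorIntegral L G ε p i j = sectorIntegral L G ε p j i) ∧
    2 * ∑ i, ∑ j ∈ Finset.Ioi i, sectorIntegral L G ε p i j =
      2 * Real.pi * ((n : ℝ) - 2) * L ^ 2 ∧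
    area L (region p) = 2 * ∑ i, ∑ j ∈ Finset.Ioi i, sectorIntegral L G ε p i j := by
  -- There are `m + 1` edges with `m = 4 * n - 5`, hence `(m - 3) * (π / 2) = 2 * π * (n - 2)`; the
  -- truncated subtractions are exact because `n ≥ 2`.
  obtain ⟨m, hm⟩ : ∃ m, 4 * (n - 1) = m + 1 := ⟨4 * (n - 1) - 1, by omega⟩
  have hmn : (m : ℝ) = 4 * n - 5 := by
    have : m + 5 = 4 * n := by omega
    have : (m : ℝ) + 5 = 4 * n := by exact_mod_cast this
    linarith
  have hm2 : 2 ≤ m := by omega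
  generalize 4 * (n - 1) = e at p hp hm
  subst hm
  have htot := two_mul_sum_sectorIntegral hm2 hL hG hε hp
  refine ⟨geodesicsMeeting_eq hm2 hp, fun i j k l _ _ h => sector_aedisjoint hm2 hp h,
    fun i j _ => (integrableOn_weightedChord hL hG hε hp).mono_set fun γ hγ => hγ.1,
    fun i j _ => sectorIntegral_comm hm2 hL hG hε hp i j, ?_, htot.symm⟩
  rw [htot, area_rightAngledPolygon hm2 hL hp, hmn]
  ring
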